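/- Let $T\ge 1$, let $X_1,\dots,X_T$ be random variables on a probability space with values in a separable Banach space $\mathcal X$, and let $f:\mathcal X\to\mathbb R$ be measurable. For $0\le k<T$ let $\pi_{k+1}(\cdot\mid x_{1:k})$ be a regular conditional distribution of $X_{k+1}$ given $X_{1:k}=x_{1:k}$, from which one can sample. Let $U_T=\sup_\tau \mathbb E[f(X_\tau)]$, the supremum being over all stopping times $\tau$ of the natural filtration with values in $\{1,\dots,T\}$, and for $1\le k\le T-1$ let $U_{T-k}(x_{1:k})=\sup_{\tau}\mathbb E[f(X_\tau)\mid X_{1:k}=x_{1:k}]$ be the value, given the history $x_{1:k}$, of the stopping problem with $\tau\in\{k+1,\dots,T\}$. Assume that * $\mathbb E\|X_i\|^{2+\delta}<\infty$ for all $1\le i\le T$, for some $\delta>0$; * $|f(x)|\le L(1+\|x\|)$ for all $x\in\mathcal X$, for some constant $L$; * there is a constant $C$ with $\mathbb P\big(|U_{T-k}(X_1,\dots,X_k)-f(X_k)|<\varepsilon\big)\le C\varepsilon$ for all $\varepsilon>0$ and $1\le k\le T-1$. Let $0<\eta\le\delta$ with $\eta<1/4$, and for $1\le i\le T-1$ put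 $$r_i=1-2^{-\frac{2+9d_i/(80+40d_i)}{2+d_i/10}},\qquad d_i=\eta\cdot 10^{\,i+1-T}.$$ The multi-stage MUSE is the following recursive randomized algorithm, started with $k=0$ and the empty history. Given $x_{1:k}$, sample $x_{k+1}\sim\pi_{k+1}(\cdot\mid x_{1:k})$. If $k=T-1$, return $f(x_T)$. Otherwise sample independently $N$ with $\mathbb P(N=n)=p(n):=r_{k+1}(1-r_{k+1})^n$, $n\ge0$, call the algorithm independently $2^N$ times with the history $x_{1:k+1}$ to get $Y(1),\dots,Y(2^N)$, and return $\Delta_N/p(N)$, where $\Delta_0=\max\{f(x_{k+1}),Y(1)\}$ and, for $N\ge1$, $$\Delta_N=\max\{f(x_{k+1}),A\}-\tfrac12\big[\max\{f(x_{k+1}),A^O\}+\max\{f(x_{k+1}),A^E\}\big],$$ $A$, $A^O$, $A^E$ being the averages of the $Y(j)$ over all $j$, the odd $j$ and the even $j$. The computational cost is the random number of units used, where sampling one random variable, evaluating $f$ once, and performing one arithmetic operation cost one unit each. Then the output $Y_1$ of the multi-stage MUSE has a finite second moment, and there is a constant $K$, not depending on $\varepsilon$, such that for every $\varepsilon>0$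 the average $Y$ of $n=\max\{1,\lceil \mathrm{Var}(Y_1)/\varepsilon^2\rceil\}$ i.i.d. copies of $Y_1$ satisfies $$\mathbb E\big[(Y-U_T)^2\big]\le\varepsilon^2,$$ and the expected computational cost of $Y$ is at most $K\max\{1,1/\varepsilon^2\}$; in particular it is $O(1/\varepsilon^2)$ as $\varepsilon\to0$. -/

import Mathlib

open MeasureTheory ProbabilityTheory

noncomputable section

namespace MUSE

variable {𝒳 : Type*} [MeasurableSpace 𝒳]

/-! ### Histories and simulators

Times are numbered from `0`: `X i` is the `(i + 1)`-st observation. A history of length `k` is an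
element of `Fin k → 𝒳`. -/

/-- The first `k` observations of the process. -/
def past {Ω : Type*} {T : ℕ} (X : Fin T → Ω → 𝒳) (k : ℕ) (hk : k ≤ T) (ω : Ω) : Fin k → 𝒳 :=
  fun i => X (Fin.castLE hk i) ω

/-- Append an observation to a history. -/
def extend {k : ℕ} (p : (Fin k → 𝒳) × 𝒳) : Fin (k + 1) → 𝒳 :=
  Fin.snoc (α := fun _ => 𝒳) p.1 p.2

/-- Put an observation in front of a path. -/
def prepend {m : ℕ} (p : 𝒳 × (Fin m → 𝒳)) : Fin (m + 1) → 𝒳 :=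
  Fin.cons (α := fun _ => 𝒳) p.1 p.2

lemma measurable_extend {k : ℕ} : Measurable (extend (𝒳 := 𝒳) (k := k)) := by
  refine measurable_pi_iff.2 fun i => ?_
  refine Fin.lastCases ?_ (fun j => ?_) i
  · simpa [extend] using measurable_snd
  · simp only [extend, Fin.snoc_castSucc]
    fun_prop

/-- The kernels `π` simulate the process `X`: for every `k < T`, `π k` is (a version of) the
conditional distribution of the next observation given the first `k` observations. -/
def Simulates {Ω : Type*} [MeasurableSpace Ω] (P : Measure Ω) {T : ℕ} (X : Fin T → Ω → 𝒳)
    (π : (k : ℕ) → Kernel (Fin k → 𝒳) 𝒳) : Prop :=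
  ∀ (k : ℕ) (hk : k < T), HasCondDistrib (X ⟨k, hk⟩) (past X k hk.le) (π k) P

/-- The conditional law of the next `m` observations given a history of length `k`. -/
def tailLaw (π : (k : ℕ) → Kernel (Fin k → 𝒳) 𝒳) :
    (m k : ℕ) → Kernel (Fin k → 𝒳) (Fin m → 𝒳)
  | 0, _ => Kernel.const _ (Measure.dirac Fin.elim0)
  | m + 1, k => (π k ⊗ₖ (tailLaw π m (k + 1)).comap extend measurable_extend).map prepend

/-! ### Optimal stopping -/

section Stopping

variable [TopologicalSpace 𝒳] [TopologicalSpace.MetrizableSpace 𝒳] [BorelSpace 𝒳]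

/-- The value `sup_τ E[f(Z_τ)]` of the optimal stopping problem for the process
`Z_0, …, Z_{m-1}`, over all stopping times of its natural filtration with values in
`{0, …, m - 1}`. -/
def stoppingValue {Ω : Type*} [MeasurableSpace Ω] (μ : Measure Ω) {m : ℕ} (Z : Fin m → Ω → 𝒳)
    (hZ : ∀ i, StronglyMeasurable (Z i)) (f : 𝒳 → ℝ) : ℝ :=
  sSup {v : ℝ | ∃ τ : Ω → Fin m,
    IsStoppingTime (Filtration.natural Z hZ) (fun ω => (τ ω : WithTop (Fin m))) ∧
    v = ∫ ω, f (Z (τ ω) ω) ∂μ}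

/-- The conditional utility: the value of the stopping problem with `m` remaining observations,
given the history `h` of the first `k` observations. -/
def condUtility [SecondCountableTopology 𝒳] (π : (k : ℕ) → Kernel (Fin k → 𝒳) 𝒳) (f : 𝒳 → ℝ)
    (m k : ℕ) (h : Fin k → 𝒳) : ℝ :=
  stoppingValue (tailLaw π m k h) (fun (i : Fin m) (x : Fin m → 𝒳) => x i)
    (fun i => (measurable_pi_apply i).stronglyMeasurable) f

end Stopping

/-! ### The multi-stage estimator

A randomized algorithm that is given a history is described by the kernel that sends the history to
the joint law of its real output and of the number of units of computation it has used. Sampling one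
random variable and performing one arithmetic operation (addition, subtraction, multiplication,
division, maximum, evaluation of `f`) cost one unit each. -/

/-- `n` conditionally independent runs of the randomized procedure `K`. (The value for kernels that
are not Markov is irrelevant.) -/
def iid {α β : Type*} [MeasurableSpace α] [MeasurableSpace β] (K : Kernel α β) (n : ℕ) :
    Kernel α (Fin n → β) :=
  open Classical in
  if hK : IsMarkovKernel K then
    { toFun := fun a => Measure.pi fun _ : Fin n => K a
      measurable' := by
        have := hK
        refine Measurable.measure_of_isPiSystem_of_isProbabilityMeasure
          generateFrom_pi.symm isPiSystem_pi ?_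
        rintro _ ⟨s, hs, rfl⟩
        simp only [Measure.pi_pi]
        exact Finset.measurable_prod _ fun i _ => K.measurable_coe (hs i (Set.mem_univ i)) }
  else 0

/-- The probability mass function `p_r(n) = r (1 - r) ^ n` of the geometric distribution. -/
def geoPMF (r : unitInterval) (n : ℕ) : ℝ := r * (1 - r) ^ n

/-- The antithetic difference `Δ_n` built from `a = f(x)` and `2 ^ n` numbers `y`. The sums over odd
and even positions (numbered from `1`) run over the indices `2 * i` and `2 * i + 1` of `y`. -/
def delta : (n : ℕ) → ℝ → (Fin (2 ^ n) → ℝ) → ℝ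
  | 0, a, y => max a (y 0)
  | n + 1, a, y =>
    max a ((∑ i, y i) / 2 ^ (n + 1)) -
      1 / 2 * (max a ((∑ i : Fin (2 ^ n), y ⟨2 * i, by have := i.2; rw [pow_succ]; omega⟩) / 2 ^ n) +
        max a ((∑ i : Fin (2 ^ n), y ⟨2 * i + 1, by have := i.2; rw [pow_succ]; omega⟩) / 2 ^ n))

/-- The number of arithmetic operations needed to compute `Δ_n / p_r(n)` from `f(x)` and the `2 ^ n`
numbers. For `n = 0`: a maximum, and a division by `p_r(0) = r`. For `n + 1`: the three sums take
`(2 ^ (n + 1) - 1) + 2 * (2 ^ n - 1) = 2 ^ (n + 2) - 3` additions, the powers of two `n`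
multiplications, `Δ` another `3` divisions, `3` maxima, and `3` operations to combine them,
`p_r(n + 1)` takes a subtraction and `n + 1` multiplications, and there is one last division. -/
def arithCost : ℕ → ℕ
  | 0 => 2
  | n + 1 => 2 ^ (n + 2) + 2 * n + 9

/-- Output and cost of one call that has sampled the observation `x` and the level `n` and whose
`2 ^ n` recursive calls have returned the outputs and costs `y`; here `a = f(x)`. The summand `3`
pays for sampling `x`, for sampling `n`, and for evaluating `f`. -/
def combine (r : unitInterval) (n : ℕ) (a : ℝ) (y : Fin (2 ^ n) → ℝ × ℕ) : ℝ × ℕ :=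
  (delta n a (fun i => (y i).1) / geoPMF r n, (∑ i, (y i).2) + 3 + arithCost n)

/-- The remainder of a call, after the history has been extended to length `k + 1` and the level `n`
has been sampled: run the procedure `K` on the extended history `2 ^ n` times and combine. -/
def branch (f : 𝒳 → ℝ) (r : unitInterval) {k : ℕ} (K : Kernel (Fin (k + 1) → 𝒳) (ℝ × ℕ)) :
    Kernel ((Fin (k + 1) → 𝒳) × ℕ) (ℝ × ℕ) where
  toFun p := ((Kernel.id ×ₖ iid K (2 ^ p.2)).map
    fun q => combine r p.2 (f (q.1 (Fin.last k))) q.2) p.1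
  measurable' := measurable_from_prod_countable_left fun n => Kernel.measurable
    ((Kernel.id ×ₖ iid K (2 ^ n)).map fun q => combine r n (f (q.1 (Fin.last k))) q.2)

/-- The multi-stage estimator for a history of length `k` with `m + 1` observations to come: the
joint law of output and cost. With one observation to come, sample it and return its reward.
Otherwise sample the next observation `x` given the history and, independently, the level
`n ~ Geo(r (k + 1))`, call the estimator `2 ^ n` times on the extended history, and return
`Δ_n / p_r(n)`. -/
def muse (π : (k : ℕ) → Kernel (Fin k → 𝒳) 𝒳) (f : 𝒳 → ℝ) (r : ℕ → unitInterval) :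
    (m k : ℕ) → Kernel (Fin k → 𝒳) (ℝ × ℕ)
  | 0, k => (π k).map fun x => (f x, 2)
  | m + 1, k =>
    branch f (r (k + 1)) (muse π f r m (k + 1)) ∘ₖ
      ((Kernel.id ×ₖ π k).map extend ×ₖ Kernel.const _ (geometricMeasure (r (k + 1))))

/-- Joint law of output and cost of the multi-stage estimator for horizon `T ≥ 1`, started from the
empty history. -/
def museLaw (π : (k : ℕ) → Kernel (Fin k → 𝒳) 𝒳) (f : 𝒳 → ℝ) (r : ℕ → unitInterval) (T : ℕ) :
    Measure (ℝ × ℕ) :=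
  muse π f r (T - 1) 0 Fin.elim0

/-- Joint law of output and cost of the average of `n` independent runs of an algorithm with law
`μ`. Averaging takes `n - 1` additions and one division. -/
def averageLaw (μ : Measure (ℝ × ℕ)) (n : ℕ) : Measure (ℝ × ℕ) :=
  (Measure.pi fun _ : Fin n => μ).map fun y => ((∑ i, (y i).1) / n, (∑ i, (y i).2) + n)

/-- The exponent `(2 + 9 d / (80 + 40 d)) / (2 + δ 10 ^ (i - T))` with `d = δ 10 ^ (i + 1 - T)`. -/
def rate (T : ℕ) (δ : ℝ) (i : ℕ) : ℝ :=
  (2 + 9 * (δ * (10 : ℝ) ^ ((i : ℤ) + 1 - T)) / (80 + 40 * (δ * (10 : ℝ) ^ ((i : ℤ) + 1 - T)))) /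
    (2 + δ * (10 : ℝ) ^ ((i : ℤ) - T))

lemma rate_nonneg (T : ℕ) {δ : ℝ} (hδ : 0 < δ) (i : ℕ) : 0 ≤ rate T δ i := by
  unfold rate; positivity

/-- The parameter `r_i = 1 - 2 ^ (- rate)` of the `i`-th level variable, `1 ≤ i ≤ T - 1`. -/
def museParam (T : ℕ) (δ : ℝ) (hδ : 0 < δ) (i : ℕ) : unitInterval :=
  ⟨1 - (2 : ℝ) ^ (-rate T δ i), by
    constructor
    · have : (2 : ℝ) ^ (-rate T δ i) ≤ 1 :=
        Real.rpow_le_one_of_one_le_of_nonpos one_le_two (neg_nonpos.2 (rate_nonneg T hδ i))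
      linarith
    · have : 0 < (2 : ℝ) ^ (-rate T δ i) := Real.rpow_pos_of_pos two_pos _
      linarith⟩

/-- The number of copies to average: `V / ε ^ 2`, rounded up to a positive integer. -/
def sampleSize (V ε : ℝ) : ℕ := max 1 ⌈V / ε ^ 2⌉₊

end MUSE

end

noncomputable section

namespace MUSE

variable {𝒳 : Type*} [MeasurableSpace 𝒳]

/-! The estimator divides an antithetic difference by the probability of its random level, so its
mean is the sum over n of the mean differences. Each half of a sample of size `2 ^ (n + 1)` has the
law of a sample of size `2 ^ n`; the sum therefore telescopes to the limit of E max(a, average of `2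
^ n` copies), which is max(a, u) with a = f(x) and u the mean of one recursive call
(`hasSum_integral_delta`). If the recursive calls are unbiased for the value of continuing, this is
the Bellman equation, and backward induction identifies its solution with the optimal stopping
values (`condUtility_eq_contValue`, `stoppingValue_eq_contValue`).

The delicate point is a moment of order above two. Put p = 2 + d and q = 2 + d/10, and let M be the
larger deviation of the two half averages from u. The difference is at most M, and it vanishes when
M < |u - a|, because then both halves lie on the same side of the kink of max(a, ·) as u. A p-th
moment of the calls gives E M^p of order 2^(-np/2) (`integral_abs_sum_rpow_le`). Thus the difference
is small in the mean unless |u - a| < ε, an event of probability at most Cε. Optimizing ε and a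
truncation level s (`rpow_exponent_bounds`) bounds the q-th moment of the level-n difference by a
multiple of 2^(-n(ρq - 1)), where 2^(-ρ) is the ratio of the geometric law. The weights p(n)^(1-q)
grow like 2^(nρ(q-1)), so the q-th moment of the call is bounded by a series with ratio 2^(1-ρ), and
it converges because ρ > 1 (`lintegral_muse_succ_rpow_lt_top`).

Each stage thus divides the surplus d by ten and keeps it positive; `muse_moment_and_mean` runs this
induction together with unbiasedness. The same inequality ρ > 1 makes E 2^N finite, hence the
expected cost (`exists_cost_le`). Averaging about Var/ε² independent runs then gives the error bound
and the cost bound. -/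

lemma iid_apply {α β : Type*} [MeasurableSpace α] [MeasurableSpace β] (K : Kernel α β)
    [hK : IsMarkovKernel K] (n : ℕ) (a : α) : iid K n a = Measure.pi fun _ : Fin n => K a := by
  simp only [iid, dif_pos hK]; rfl

instance isMarkovKernel_iid {α β : Type*} [MeasurableSpace α] [MeasurableSpace β] (K : Kernel α β)
    [IsMarkovKernel K] (n : ℕ) : IsMarkovKernel (iid K n) :=
  ⟨fun a => by rw [iid_apply]; infer_instance⟩

lemma measurable_delta (n : ℕ) :
    Measurable fun q : ℝ × (Fin (2 ^ n) → ℝ) => delta n q.1 q.2 := by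
  cases n with
  | zero => simp only [delta]; fun_prop
  | succ n => simp only [delta]; fun_prop

lemma measurable_combine (r : unitInterval) (n : ℕ) :
    Measurable fun q : ℝ × (Fin (2 ^ n) → ℝ × ℕ) => combine r n q.1 q.2 := by
  refine Measurable.prodMk ?_ ?_
  · refine Measurable.div_const ?_ _
    exact (measurable_delta n).comp (f := fun q : ℝ × (Fin (2 ^ n) → ℝ × ℕ) =>
      (q.1, fun i => (q.2 i).1)) (by fun_prop)
  · fun_prop

lemma measurable_combine_last {f : 𝒳 → ℝ} (hf : Measurable f) (r : unitInterval) (n k : ℕ) :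
    Measurable fun q : (Fin (k + 1) → 𝒳) × (Fin (2 ^ n) → ℝ × ℕ) =>
      combine r n (f (q.1 (Fin.last k))) q.2 :=
  (measurable_combine r n).comp (f := fun q : (Fin (k + 1) → 𝒳) × (Fin (2 ^ n) → ℝ × ℕ) =>
    (f (q.1 (Fin.last k)), q.2)) (by fun_prop)

lemma branch_apply (f : 𝒳 → ℝ) (r : unitInterval) {k : ℕ}
    (K : Kernel (Fin (k + 1) → 𝒳) (ℝ × ℕ)) (p : (Fin (k + 1) → 𝒳) × ℕ) :
    branch f r K p = ((Kernel.id ×ₖ iid K (2 ^ p.2)).map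
      fun q => combine r p.2 (f (q.1 (Fin.last k))) q.2) p.1 := rfl

lemma isMarkovKernel_branch {f : 𝒳 → ℝ} (hf : Measurable f) (r : unitInterval) {k : ℕ}
    (K : Kernel (Fin (k + 1) → 𝒳) (ℝ × ℕ)) [IsMarkovKernel K] : IsMarkovKernel (branch f r K) := by
  refine ⟨fun p => ?_⟩
  rw [branch_apply]
  have := Kernel.IsMarkovKernel.map (Kernel.id ×ₖ iid K (2 ^ p.2))
    (measurable_combine_last hf r p.2 k)
  infer_instance

lemma isMarkovKernel_muse (π : (k : ℕ) → Kernel (Fin k → 𝒳) 𝒳) [∀ k, IsMarkovKernel (π k)]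
    {f : 𝒳 → ℝ} (hf : Measurable f) (r : ℕ → unitInterval) (m k : ℕ) :
    IsMarkovKernel (muse π f r m k) := by
  induction m generalizing k with
  | zero => exact Kernel.IsMarkovKernel.map _ (by fun_prop)
  | succ m ih =>
    have := ih (k + 1)
    have := isMarkovKernel_branch hf (r (k + 1)) (muse π f r m (k + 1))
    have := Kernel.IsMarkovKernel.map (Kernel.id ×ₖ π k) (measurable_extend (𝒳 := 𝒳) (k := k))
    rw [muse]; infer_instance

/-! ### One recursion step of the algorithm as an identity of integrals -/

@[simp] lemma extend_last {E : Type*} {k : ℕ} (h : Fin k → E) (x : E) :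
    extend (h, x) (Fin.last k) = x := by
  simp [extend]

lemma lintegral_muse_zero (π : (k : ℕ) → Kernel (Fin k → 𝒳) 𝒳) {f : 𝒳 → ℝ} (hf : Measurable f)
    (r : ℕ → unitInterval) (k : ℕ) (h : Fin k → 𝒳) {F : ℝ × ℕ → ENNReal} (hF : Measurable F) :
    ∫⁻ z, F z ∂muse π f r 0 k h = ∫⁻ x, F (f x, 2) ∂π k h := by
  rw [muse, Kernel.lintegral_map _ (by fun_prop) _ hF]

lemma lintegral_branch {f : 𝒳 → ℝ} (hf : Measurable f) (r : unitInterval) {k : ℕ}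
    (K : Kernel (Fin (k + 1) → 𝒳) (ℝ × ℕ)) [IsMarkovKernel K] (h : Fin (k + 1) → 𝒳) (n : ℕ)
    {F : ℝ × ℕ → ENNReal} (hF : Measurable F) :
    ∫⁻ z, F z ∂branch f r K (h, n) =
      ∫⁻ y, F (combine r n (f (h (Fin.last k))) y) ∂Measure.pi fun _ : Fin (2 ^ n) => K h := by
  have hc := measurable_combine_last hf r n k
  rw [branch_apply, Kernel.lintegral_map _ hc _ hF, ← iid_apply]
  exact Kernel.lintegral_id_prod (hF.comp hc) _ _

lemma lintegral_geometricMeasure {r : unitInterval} (hr : r ≠ 0) (F : ℕ → ENNReal) :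
    ∫⁻ n, F n ∂geometricMeasure r = ∑' n, ENNReal.ofReal (geoPMF r n) * F n := by
  rw [geometricMeasure_eq hr, lintegral_sum_measure]
  refine tsum_congr fun n => ?_
  rw [lintegral_smul_measure, lintegral_dirac, geoPMF, mul_comm (r : ℝ), smul_eq_mul]

/-- One recursion step of the estimator, for integrals of nonnegative functions of output and
cost. -/
lemma lintegral_muse_succ (π : (k : ℕ) → Kernel (Fin k → 𝒳) 𝒳) [∀ k, IsMarkovKernel (π k)]
    {f : 𝒳 → ℝ} (hf : Measurable f) (r : ℕ → unitInterval) (m k : ℕ) (hr : r (k + 1) ≠ 0)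
    (h : Fin k → 𝒳) {F : ℝ × ℕ → ENNReal} (hF : Measurable F) :
    ∫⁻ z, F z ∂muse π f r (m + 1) k h = ∫⁻ x, ∑' n, ENNReal.ofReal (geoPMF (r (k + 1)) n) *
      ∫⁻ y, F (combine (r (k + 1)) n (f x) y)
        ∂Measure.pi (fun _ : Fin (2 ^ n) => muse π f r m (k + 1) (extend (h, x))) ∂π k h := by
  have := isMarkovKernel_muse π hf r m (k + 1)
  have := isMarkovKernel_branch hf (r (k + 1)) (muse π f r m (k + 1))
  have := Kernel.IsMarkovKernel.map (Kernel.id ×ₖ π k) (measurable_extend (𝒳 := 𝒳) (k := k))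
  rw [muse, Kernel.lintegral_comp _ _ _ hF, Kernel.lintegral_prod _ _ _ hF.lintegral_kernel,
    Kernel.lintegral_map _ measurable_extend, Kernel.lintegral_id_prod]
  · refine lintegral_congr fun x => ?_
    rw [Kernel.const_apply, lintegral_geometricMeasure hr]
    refine tsum_congr fun n => ?_
    rw [lintegral_branch hf _ _ _ _ hF, extend_last]
  · refine Measurable.lintegral_prod_right' (f := fun q : ((Fin k → 𝒳) × 𝒳) × ℕ =>
      ∫⁻ b, F b ∂branch f (r (k + 1)) (muse π f r m (k + 1)) (extend q.1, q.2)) ?_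
    exact hF.lintegral_kernel.comp (by have := measurable_extend (𝒳 := 𝒳) (k := k); fun_prop)
  · exact Measurable.lintegral_prod_right' hF.lintegral_kernel

/-- The level-`n` part of `lintegral_muse_succ` is a measurable function of the history. -/
lemma measurable_lintegral_pi_muse (π : (k : ℕ) → Kernel (Fin k → 𝒳) 𝒳)
    [∀ k, IsMarkovKernel (π k)] {f : 𝒳 → ℝ} (hf : Measurable f) (r : ℕ → unitInterval) (m k : ℕ)
    (n : ℕ) {F : ℝ → (Fin n → ℝ × ℕ) → ENNReal} (hF : Measurable (Function.uncurry F)) :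
    Measurable fun h : Fin (k + 1) → 𝒳 => ∫⁻ y, F (f (h (Fin.last k))) y
      ∂Measure.pi (fun _ : Fin n => muse π f r m (k + 1) h) := by
  have := isMarkovKernel_muse π hf r m (k + 1)
  simp_rw [← iid_apply]
  refine Measurable.lintegral_kernel_prod_right (κ := iid (muse π f r m (k + 1)) n)
    (f := fun h y => F (f (h (Fin.last k))) y) ?_
  exact hF.comp (f := fun q : (Fin (k + 1) → 𝒳) × (Fin n → ℝ × ℕ) =>
    (f (q.1 (Fin.last k)), q.2)) (by fun_prop)

/-! ### Moments of sums of independent centred variables -/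

lemma rpow_mul_le_rpow_mul {s x y : ℝ} (hs : s ≤ 1) (hx : 0 ≤ x) (hxy : x ≤ y) :
    y ^ s * x ≤ x ^ s * y := by
  rcases hx.eq_or_lt with rfl | hx
  · have := Real.rpow_nonneg le_rfl s; rw [mul_zero]; positivity
  have hy := hx.trans_le hxy
  have h1 : x ^ (1 - s) ≤ y ^ (1 - s) := Real.rpow_le_rpow hx.le hxy (by linarith)
  rw [Real.rpow_sub hx, Real.rpow_sub hy, Real.rpow_one, Real.rpow_one,
    div_le_div_iff₀ (by positivity) (by positivity)] at h1
  linarith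

/-- The derivative of x ↦ x^s blows up at 0 when s < 1, so no plain Lipschitz bound is available;
the extra factor y compensates for this. It controls the change of slope in `abs_add_rpow_le`. -/
lemma abs_rpow_sub_rpow_mul_le {s x y : ℝ} (hs0 : 0 ≤ s) (hs : s ≤ 1) (hx : 0 ≤ x) (hy : 0 ≤ y) :
    |x ^ s - y ^ s| * y ≤ max x y ^ s * |x - y| := by
  rcases le_total x y with h | h
  · have h1 := rpow_mul_le_rpow_mul hs hx h
    rw [max_eq_right h, abs_of_nonpos (by linarith [Real.rpow_le_rpow hx h hs0]),
      abs_of_nonpos (by linarith)]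
    linarith
  · have h1 := rpow_mul_le_rpow_mul hs hy h
    have h2 := Real.rpow_le_rpow hy h hs0
    rw [max_eq_left h, abs_of_nonneg (by linarith), abs_of_nonneg (by linarith)]
    nlinarith [mul_nonneg (sub_nonneg.2 h2) (sub_nonneg.2 h)]

/-- The tangent line inequality for the convex function |·|^p at x, obtained from Young's inequality
for |y| · |x|^(p-1). -/
lemma abs_rpow_sub_le {p : ℝ} (hp : 2 ≤ p) (x y : ℝ) :
    |x| ^ p - |y| ^ p ≤ p * (|x| ^ (p - 2) * x) * (x - y) := by
  have hx : |x| ^ p = |x| ^ (p - 2) * x * x := by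
    rcases eq_or_ne x 0 with rfl | h
    · simp [Real.zero_rpow (by linarith : p ≠ 0)]
    · rw [Real.rpow_sub (abs_pos.2 h), mul_assoc, ← sq, ← sq_abs x]
      norm_cast
      field_simp
  have hpq : p.HolderConjugate (p / (p - 1)) := by
    constructor
    · field_simp; ring
    · linarith
    · apply div_pos <;> linarith
  have h2 := Real.young_inequality_of_nonneg (abs_nonneg y)
    (Real.rpow_nonneg (abs_nonneg x) (p - 1)) hpq
  rw [← Real.rpow_mul (abs_nonneg x), mul_div_cancel₀ _ (by linarith : p - 1 ≠ 0)] at h2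
  have h3 : |x| ^ (p - 2) * x * y ≤ |y| * |x| ^ (p - 1) := by
    have : |x| ^ (p - 1) = |x| ^ (p - 2) * |x| := by
      rw [show p - 1 = (p - 2) + 1 by ring,
        Real.rpow_add_of_nonneg (abs_nonneg x) (by linarith) one_pos.le, Real.rpow_one]
    rw [this, mul_assoc, mul_comm |y|, mul_assoc, ← abs_mul]
    exact mul_le_mul_of_nonneg_left (le_abs_self _) (Real.rpow_nonneg (abs_nonneg x) _)
  have h4 : p * (|y| ^ p / p + |x| ^ p / (p / (p - 1))) = |y| ^ p + (p - 1) * |x| ^ p := by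
    have : p ≠ 0 := by linarith
    have : p - 1 ≠ 0 := by linarith
    field_simp
  have h5 := mul_le_mul_of_nonneg_left (h3.trans h2) (by linarith : 0 ≤ p)
  rw [h4] at h5
  have : p * (|x| ^ (p - 2) * x) * (x - y) = p * |x| ^ p - p * (|x| ^ (p - 2) * x * y) := by
    rw [hx]; ring
  linarith

/-- A second-order expansion of `|x| ^ p` for `2 ≤ p ≤ 3`. -/
lemma abs_add_rpow_le {p : ℝ} (hp : 2 ≤ p) (hp3 : p ≤ 3) (a b : ℝ) :
    |a + b| ^ p ≤ |a| ^ p + p * (|a| ^ (p - 2) * a * b) +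
      2 * p * (|a| ^ (p - 2) * b ^ 2 + |b| ^ p) := by
  -- The tangent is taken at the end point a + b, which gives an upper bound; replacing its slope by
  -- the slope at a then costs only second-order terms.
  have h1 := abs_rpow_sub_le hp (a + b) a
  set s := p - 2 with hs
  have hs0 : 0 ≤ s := by linarith
  have hs1 : s ≤ 1 := by linarith
  have hm : max |a + b| |a| ^ s ≤ |a| ^ s + |b| ^ s := by
    refine (Real.rpow_le_rpow (by positivity) (max_le (abs_add_le a b) (by simp)) hs0).trans ?_
    exact Real.rpow_add_le_add_rpow (abs_nonneg a) (abs_nonneg b) hs0 hs1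
  have h2 : (|a + b| ^ s - |a| ^ s) * a * b ≤ max |a + b| |a| ^ s * b ^ 2 := by
    calc (|a + b| ^ s - |a| ^ s) * a * b ≤ |(|a + b| ^ s - |a| ^ s) * a * b| := le_abs_self _
      _ = |(|a + b| ^ s - |a| ^ s)| * |a| * |b| := by rw [abs_mul, abs_mul]
      _ ≤ max |a + b| |a| ^ s * |(|a + b| - |a|)| * |b| := by
        exact mul_le_mul_of_nonneg_right
          (abs_rpow_sub_rpow_mul_le hs0 hs1 (abs_nonneg _) (abs_nonneg _)) (abs_nonneg b)
      _ ≤ max |a + b| |a| ^ s * |b| * |b| := by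
        have : |(|a + b| - |a|)| ≤ |b| := by simpa using abs_abs_sub_abs_le_abs_sub (a + b) a
        gcongr
      _ = _ := by rw [mul_assoc, ← sq, sq_abs]
  have h3 : |a + b| ^ s * b ^ 2 ≤ max |a + b| |a| ^ s * b ^ 2 := by
    gcongr; exact le_max_left _ _
  have hb : |b| ^ s * b ^ 2 = |b| ^ p := by
    rw [← sq_abs, show p = s + 2 by linarith,
      Real.rpow_add_of_nonneg (abs_nonneg b) hs0 (by norm_num)]
    norm_cast
  have h4 : max |a + b| |a| ^ s * b ^ 2 ≤ |a| ^ s * b ^ 2 + |b| ^ p := by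
    rw [← hb, ← add_mul]; gcongr
  have h5 : |a + b| ^ s * (a + b) * (a + b - a) =
    |a| ^ s * a * b + (|a + b| ^ s - |a| ^ s) * a * b + |a + b| ^ s * b ^ 2 := by ring
  have h6 : |a + b| ^ s * (a + b) * (a + b - a) ≤
      |a| ^ s * a * b + 2 * (|a| ^ s * b ^ 2 + |b| ^ p) := by linarith
  have h7 := mul_le_mul_of_nonneg_left h6 (by linarith : 0 ≤ p)
  nlinarith

section MomentInequality

variable {Ω : Type*} [MeasurableSpace Ω] {μ : Measure Ω}

lemma integrable_abs_rpow_of_le [IsFiniteMeasure μ] {p q : ℝ} (hq : 0 ≤ q) (hqp : q ≤ p)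
    {Y : Ω → ℝ} (hY : AEStronglyMeasurable Y μ) (h : Integrable (fun ω => |Y ω| ^ p) μ) :
    Integrable (fun ω => |Y ω| ^ q) μ := by
  refine ((integrable_const (1 : ℝ)).add h).mono'
    ((hY.aemeasurable.abs.pow_const q).aestronglyMeasurable) (ae_of_all _ fun ω => ?_)
  rw [Real.norm_of_nonneg (by positivity)]
  change _ ≤ 1 + |Y ω| ^ p
  rcases le_total |Y ω| 1 with h1 | h1
  · have := Real.rpow_le_one (abs_nonneg _) h1 hq
    have := Real.rpow_nonneg (abs_nonneg (Y ω)) p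
    linarith
  · have := Real.rpow_le_rpow_of_exponent_le h1 hqp
    linarith

/-- Lyapunov's inequality: Jensen for the convex power p / q. -/
lemma integral_abs_rpow_le [IsProbabilityMeasure μ] {p q : ℝ} (hq : 0 < q) (hqp : q ≤ p)
    {Y : Ω → ℝ} (hY : AEStronglyMeasurable Y μ) (h : Integrable (fun ω => |Y ω| ^ p) μ) :
    ∫ ω, |Y ω| ^ q ∂μ ≤ (∫ ω, |Y ω| ^ p ∂μ) ^ (q / p) := by
  have hp : 0 < p := hq.trans_le hqp
  have hpq : 1 ≤ p / q := (one_le_div hq).2 hqp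
  have e : ∀ ω, (|Y ω| ^ q) ^ (p / q) = |Y ω| ^ p := fun ω => by
    rw [← Real.rpow_mul (abs_nonneg _), mul_div_cancel₀ _ hq.ne']
  have h1 := (convexOn_rpow hpq).map_integral_le (μ := μ) (f := fun ω => |Y ω| ^ q)
    (continuousOn_id.rpow_const fun _ _ => Or.inr (by positivity)) isClosed_Ici
    (ae_of_all _ fun ω => by simp only [Set.mem_Ici]; positivity)
    (integrable_abs_rpow_of_le hq.le hqp hY h)
    (by simpa only [Function.comp_def, e] using h)
  simp only [e] at h1
  have h0 : 0 ≤ ∫ ω, |Y ω| ^ q ∂μ := integral_nonneg fun ω => by positivity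
  have h2 := Real.rpow_le_rpow (by positivity) h1 (by positivity : 0 ≤ q / p)
  rwa [← Real.rpow_mul h0, div_mul_div_cancel₀ hq.ne', div_self hp.ne', Real.rpow_one] at h2

/-- With t = (p - 2)/2, (n+1)^(p/2) is (n+1)^t · n + (n+1)^t, and the last term dominates the
average of n^t and 1. Multiplied by 4pβ, this absorbs the increment 2pβ(n^t + 1) in the induction of
`integral_abs_sum_rpow_le`, which is where the constant 4p comes from. -/
lemma rpow_half_add_le {p : ℝ} (hp : 2 ≤ p) (n : ℕ) :
    (n : ℝ) ^ (p / 2) + ((n : ℝ) ^ ((p - 2) / 2) + 1) / 2 ≤ ((n : ℝ) + 1) ^ (p / 2) := by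
  have ht : 0 ≤ (p - 2) / 2 := by linarith
  have e : ∀ x : ℝ, 0 ≤ x → x ^ (p / 2) = x ^ ((p - 2) / 2) * x := fun x hx => by
    rw [show p / 2 = (p - 2) / 2 + 1 by ring, Real.rpow_add_of_nonneg hx ht one_pos.le,
      Real.rpow_one]
  have hn : (0 : ℝ) ≤ n := n.cast_nonneg
  rw [e _ hn, e _ (by linarith)]
  have h1 : (n : ℝ) ^ ((p - 2) / 2) ≤ ((n : ℝ) + 1) ^ ((p - 2) / 2) :=
    Real.rpow_le_rpow hn (by linarith) ht
  have h2 : 1 ≤ ((n : ℝ) + 1) ^ ((p - 2) / 2) := Real.one_le_rpow (by linarith) ht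
  nlinarith [mul_le_mul_of_nonneg_right h1 hn]

/-- A Marcinkiewicz–Zygmund inequality for exponents between `2` and `3`. -/
theorem integral_abs_sum_rpow_le [IsProbabilityMeasure μ] {ι : Type*} {Y : ι → Ω → ℝ}
    (hY : ∀ i, Measurable (Y i)) (hind : iIndepFun Y μ) {p β : ℝ} (hp : 2 < p) (hp3 : p ≤ 3)
    (hpow : ∀ i, Integrable (fun ω => |Y i ω| ^ p) μ) (h0 : ∀ i, ∫ ω, Y i ω ∂μ = 0)
    (hβ : ∀ i, ∫ ω, |Y i ω| ^ p ∂μ ≤ β) (s : Finset ι) :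
    Integrable (fun ω => |∑ i ∈ s, Y i ω| ^ p) μ ∧
      ∫ ω, |∑ i ∈ s, Y i ω| ^ p ∂μ ≤ 4 * p * β * (s.card : ℝ) ^ (p / 2) := by
  classical
  -- The second moment is carried through the induction: since p - 2 ≤ 1, it bounds E|S|^(p-2) by
  -- Lyapunov's inequality. In the expansion of |S + Y|^p the first-order term vanishes by
  -- independence and centring.
  suffices H : Integrable (fun ω => |∑ i ∈ s, Y i ω| ^ p) μ ∧
      ∫ ω, |∑ i ∈ s, Y i ω| ^ p ∂μ ≤ 4 * p * β * (s.card : ℝ) ^ (p / 2) ∧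
      ∫ ω, |∑ i ∈ s, Y i ω| ^ (2 : ℝ) ∂μ ≤ s.card * β ^ (2 / p) from ⟨H.1, H.2.1⟩
  have hp0 : 0 < p := by linarith
  induction s using Finset.induction_on with
  | empty => simp [Real.zero_rpow hp0.ne', Real.zero_rpow (by linarith : p / 2 ≠ 0)]
  | insert i s hi ih =>
    obtain ⟨ih1, ih2, ih3⟩ := ih
    have hβ0 : 0 ≤ β := (integral_nonneg fun ω => by positivity).trans (hβ i)
    set S : Ω → ℝ := fun ω => ∑ j ∈ s, Y j ω with hS
    have hSm : Measurable S := by fun_prop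
    have hSi : IndepFun S (Y i) μ := by
      have := hind.indepFun_finsetSum_of_notMem hY hi
      convert this using 1
      ext ω; simp [hS]
    have eb : ∀ ω, Y i ω ^ 2 = |Y i ω| ^ (2 : ℝ) := fun ω => by
      rw [← sq_abs]; norm_cast
    have iS2 : Integrable (fun ω => |S ω| ^ (p - 2)) μ :=
      integrable_abs_rpow_of_le (by linarith) (by linarith) hSm.aestronglyMeasurable ih1
    have iS1 : Integrable (fun ω => |S ω| ^ (p - 2) * S ω) μ := by
      refine (integrable_abs_rpow_of_le (q := p - 1) (by linarith) (by linarith)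
        hSm.aestronglyMeasurable ih1).mono' (by fun_prop) (ae_of_all _ fun ω => ?_)
      rw [norm_mul, Real.norm_of_nonneg (by positivity), Real.norm_eq_abs,
        show p - 1 = (p - 2) + 1 by ring,
        Real.rpow_add_of_nonneg (abs_nonneg _) (by linarith) one_pos.le, Real.rpow_one]
    have iS : Integrable S μ := by
      refine (integrable_abs_rpow_of_le (q := 1) (by linarith) (by linarith)
        hSm.aestronglyMeasurable ih1).mono' (by fun_prop) (ae_of_all _ fun ω => ?_)
      rw [Real.rpow_one, Real.norm_eq_abs]
    have iSS : Integrable (fun ω => |S ω| ^ (2 : ℝ)) μ :=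
      integrable_abs_rpow_of_le (by linarith) (by linarith) hSm.aestronglyMeasurable ih1
    have iY : Integrable (Y i) μ := by
      refine (integrable_abs_rpow_of_le (q := 1) (by linarith) (by linarith)
        (hY i).aestronglyMeasurable (hpow i)).mono' (hY i).aestronglyMeasurable
        (ae_of_all _ fun ω => ?_)
      rw [Real.rpow_one, Real.norm_eq_abs]
    have iY2 : Integrable (fun ω => Y i ω ^ 2) μ := by
      simp only [eb]
      exact integrable_abs_rpow_of_le (by linarith) (by linarith)
        (hY i).aestronglyMeasurable (hpow i)
    have ind1 : IndepFun (fun ω => |S ω| ^ (p - 2) * S ω) (Y i) μ :=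
      hSi.comp (φ := fun x => |x| ^ (p - 2) * x) (ψ := id) (by fun_prop) measurable_id
    have ind2 : IndepFun (fun ω => |S ω| ^ (p - 2)) (fun ω => Y i ω ^ 2) μ :=
      hSi.comp (φ := fun x => |x| ^ (p - 2)) (ψ := fun x => x ^ 2) (by fun_prop) (by fun_prop)
    have i1 : Integrable (fun ω => |S ω| ^ (p - 2) * S ω * Y i ω) μ := ind1.integrable_mul iS1 iY
    have i2 : Integrable (fun ω => |S ω| ^ (p - 2) * Y i ω ^ 2) μ := ind2.integrable_mul iS2 iY2
    have e1 : ∫ ω, |S ω| ^ (p - 2) * S ω * Y i ω ∂μ = 0 := by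
      rw [ind1.integral_fun_mul_eq_mul_integral iS1.1 iY.1, h0, mul_zero]
    have e2 := ind2.integral_fun_mul_eq_mul_integral iS2.1 iY2.1
    have hS2 : ∫ ω, |S ω| ^ (p - 2) ∂μ ≤ (s.card * β ^ (2 / p)) ^ ((p - 2) / 2) :=
      (integral_abs_rpow_le (by linarith) (by linarith) hSm.aestronglyMeasurable iSS).trans
        (Real.rpow_le_rpow (integral_nonneg fun ω => by positivity) ih3 (by linarith))
    have hY2 : ∫ ω, Y i ω ^ 2 ∂μ ≤ β ^ (2 / p) := by
      simp only [eb]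
      exact (integral_abs_rpow_le (by linarith) hp.le (hY i).aestronglyMeasurable (hpow i)).trans
        (Real.rpow_le_rpow (integral_nonneg fun ω => by positivity) (hβ i) (by positivity))
    have hprod : ∫ ω, |S ω| ^ (p - 2) * Y i ω ^ 2 ∂μ ≤ (s.card : ℝ) ^ ((p - 2) / 2) * β := by
      rw [e2]
      calc _ ≤ (s.card * β ^ (2 / p)) ^ ((p - 2) / 2) * β ^ (2 / p) :=
            mul_le_mul hS2 hY2 (integral_nonneg fun ω => by positivity) (by positivity)
        _ = _ := by
            rw [Real.mul_rpow (by positivity) (by positivity), ← Real.rpow_mul hβ0, mul_assoc,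
              ← Real.rpow_add_of_nonneg hβ0
                (mul_nonneg (by positivity) (by linarith)) (by positivity)]
            congr 1
            rw [show 2 / p * ((p - 2) / 2) + 2 / p = 1 by field_simp; ring, Real.rpow_one]
    have ia : Integrable (fun ω => |S ω| ^ p + p * (|S ω| ^ (p - 2) * S ω * Y i ω)) μ :=
      ih1.add (i1.const_mul p)
    have ic : Integrable (fun ω => |S ω| ^ (p - 2) * Y i ω ^ 2 + |Y i ω| ^ p) μ := i2.add (hpow i)
    have ib : Integrable (fun ω => |S ω| ^ p + p * (|S ω| ^ (p - 2) * S ω * Y i ω) +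
        2 * p * (|S ω| ^ (p - 2) * Y i ω ^ 2 + |Y i ω| ^ p)) μ :=
      ia.add (ic.const_mul (2 * p))
    have hb : ∀ ω, |S ω + Y i ω| ^ p ≤ |S ω| ^ p + p * (|S ω| ^ (p - 2) * S ω * Y i ω) +
        2 * p * (|S ω| ^ (p - 2) * Y i ω ^ 2 + |Y i ω| ^ p) :=
      fun ω => abs_add_rpow_le hp.le hp3 (S ω) (Y i ω)
    have iT : Integrable (fun ω => |S ω + Y i ω| ^ p) μ :=
      ib.mono' (Measurable.aestronglyMeasurable (by fun_prop)) (ae_of_all _ fun ω => by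
        rw [Real.norm_of_nonneg (by positivity)]; exact hb ω)
    have eS : ∀ ω, ∑ j ∈ insert i s, Y j ω = S ω + Y i ω := fun ω => by
      rw [Finset.sum_insert hi, add_comm]
    simp only [eS, Finset.card_insert_of_notMem hi]
    push_cast
    refine ⟨iT, ?_, ?_⟩
    · have h1 := integral_mono iT ib hb
      rw [integral_add ia (ic.const_mul (2 * p)),
        integral_add ih1 (i1.const_mul p), integral_const_mul, integral_const_mul,
        integral_add i2 (hpow i), e1] at h1
      have h3 := rpow_half_add_le hp.le s.card
      have h4 := mul_le_mul_of_nonneg_left h3 (by positivity : 0 ≤ 4 * p * β)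
      have h5 := mul_le_mul_of_nonneg_left (add_le_add hprod (hβ i)) (by positivity : 0 ≤ 2 * p)
      calc _ ≤ _ := h1
        _ ≤ 4 * p * β * (s.card : ℝ) ^ (p / 2) + p * 0 +
            2 * p * ((s.card : ℝ) ^ ((p - 2) / 2) * β + β) := add_le_add (by linarith) h5
        _ ≤ _ := by linarith
    · have e3 : ∀ ω, |S ω + Y i ω| ^ (2 : ℝ) = |S ω| ^ (2 : ℝ) + 2 * (S ω * Y i ω) + Y i ω ^ 2 :=
        fun ω => by
          have : ∀ x : ℝ, |x| ^ (2 : ℝ) = x ^ 2 := fun x => by rw [← sq_abs]; norm_cast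
          rw [this, this]; ring
      have i3 : Integrable (fun ω => S ω * Y i ω) μ := hSi.integrable_mul iS iY
      have i4 : Integrable (fun ω => |S ω| ^ (2 : ℝ) + 2 * (S ω * Y i ω)) μ :=
        iSS.add (i3.const_mul 2)
      simp only [e3]
      rw [integral_add i4 iY2, integral_add iSS (i3.const_mul 2),
        integral_const_mul, hSi.integral_fun_mul_eq_mul_integral iS.1 iY.1, h0]
      linarith

end MomentInequality

/-! ### The antithetic differences -/

section Delta

variable {α : Type*} [MeasurableSpace α]

/-- A subfamily of independent coordinates, selected without repetition, is again independent with
the same marginals. Applied to the even and the odd positions, it gives each half sample the law of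
a full sample of the previous level. -/
lemma measurePreserving_pi_comp {ι ι' : Type*} [Fintype ι] [Fintype ι'] (κ : Measure α)
    [IsProbabilityMeasure κ] {e : ι' → ι} (he : Function.Injective e) :
    MeasurePreserving (fun (y : ι → α) i => y (e i)) (Measure.pi fun _ => κ)
      (Measure.pi fun _ => κ) := by
  refine ⟨by fun_prop, ?_⟩
  have h1 : iIndepFun (fun i (y : ι → α) => y i) (Measure.pi fun _ => κ) :=
    iIndepFun_pi (X := fun _ => id) fun _ => aemeasurable_id
  have h2 := (iIndepFun_iff_map_fun_eq_pi_map
    (fun i => (measurable_pi_apply (e i)).aemeasurable)).1 (h1.precomp he)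
  rw [h2]
  congr 1
  ext1 i
  exact (measurePreserving_eval (fun _ => κ) (e i)).map_eq

lemma abs_sub_rpow_le {p : ℝ} (hp : 0 ≤ p) (hp3 : p ≤ 3) (x y : ℝ) :
    |x - y| ^ p ≤ 8 * (|x| ^ p + |y| ^ p) := by
  have h1 : |x - y| ≤ 2 * max |x| |y| := by
    have := abs_sub x y
    have := le_max_left |x| |y|
    have := le_max_right |x| |y|
    linarith
  have h2 : max |x| |y| ^ p ≤ |x| ^ p + |y| ^ p := by
    rcases max_choice |x| |y| with h | h <;> rw [h]
    · have := Real.rpow_nonneg (abs_nonneg y) p; linarith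
    · have := Real.rpow_nonneg (abs_nonneg x) p; linarith
  have h3 : (2 : ℝ) ^ p ≤ 8 := by
    calc (2 : ℝ) ^ p ≤ 2 ^ (3 : ℝ) := Real.rpow_le_rpow_of_exponent_le one_le_two hp3
      _ = 8 := by norm_num
  calc |x - y| ^ p ≤ (2 * max |x| |y|) ^ p := Real.rpow_le_rpow (abs_nonneg _) h1 hp
    _ = 2 ^ p * max |x| |y| ^ p := Real.mul_rpow (by norm_num) (by positivity)
    _ ≤ _ := by gcongr

variable {κ : Measure α} [IsProbabilityMeasure κ] {g : α → ℝ} {p : ℝ}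

lemma integrable_of_abs_rpow (hg : Measurable g) (hp : 1 ≤ p)
    (hpow : Integrable (fun z => |g z| ^ p) κ) : Integrable g κ := by
  refine (integrable_abs_rpow_of_le (q := 1) zero_le_one hp
    hg.aestronglyMeasurable hpow).mono' hg.aestronglyMeasurable (ae_of_all _ fun z => ?_)
  rw [Real.rpow_one, Real.norm_eq_abs]

/-- The constant is 8 · (1 + 1): the factor 8 from `abs_sub_rpow_le`, and |u|^p is at most the p-th
moment by Lyapunov. -/
lemma integral_abs_sub_mean_rpow_le (hg : Measurable g) (hp : 2 < p) (hp3 : p ≤ 3)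
    (hpow : Integrable (fun z => |g z| ^ p) κ) :
    Integrable (fun z => |g z - ∫ w, g w ∂κ| ^ p) κ ∧
      ∫ z, |g z - ∫ w, g w ∂κ| ^ p ∂κ ≤ 16 * ∫ z, |g z| ^ p ∂κ := by
  set u := ∫ w, g w ∂κ
  have ib : Integrable (fun z => 8 * (|g z| ^ p + |u| ^ p)) κ :=
    (hpow.add (integrable_const _)).const_mul 8
  have hb : ∀ z, |g z - u| ^ p ≤ 8 * (|g z| ^ p + |u| ^ p) :=
    fun z => abs_sub_rpow_le (by linarith) hp3 _ _
  have i1 : Integrable (fun z => |g z - u| ^ p) κ :=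
    ib.mono' (Measurable.aestronglyMeasurable (by fun_prop)) (ae_of_all _ fun z => by
      rw [Real.norm_of_nonneg (by positivity)]; exact hb z)
  refine ⟨i1, ?_⟩
  have h1 := integral_mono i1 ib hb
  rw [integral_const_mul, integral_add hpow (integrable_const _)] at h1
  simp only [integral_const, probReal_univ, one_smul] at h1
  have h2 : |u| ^ p ≤ ∫ z, |g z| ^ p ∂κ := by
    have h3 : |u| ≤ (∫ z, |g z| ^ p ∂κ) ^ (1 / p) := by
      refine (abs_integral_le_integral_abs).trans ?_
      simpa using integral_abs_rpow_le (q := 1) one_pos (by linarith) hg.aestronglyMeasurable hpow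
    have h0 : 0 ≤ ∫ z, |g z| ^ p ∂κ := integral_nonneg fun ω => by positivity
    have h4 := Real.rpow_le_rpow (abs_nonneg u) h3 (by linarith : 0 ≤ p)
    rwa [← Real.rpow_mul h0, one_div_mul_cancel (by linarith), Real.rpow_one] at h4
  linarith

/-- The central moments of an average of independent copies. -/
lemma integral_abs_average_sub_rpow_le (hg : Measurable g) (hp : 2 < p) (hp3 : p ≤ 3)
    (hpow : Integrable (fun z => |g z| ^ p) κ) (n : ℕ) :
    Integrable (fun y : Fin (2 ^ n) → α => |(∑ i, g (y i)) / 2 ^ n - ∫ w, g w ∂κ| ^ p)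
      (Measure.pi fun _ => κ) ∧
    ∫ y : Fin (2 ^ n) → α, |(∑ i, g (y i)) / 2 ^ n - ∫ w, g w ∂κ| ^ p ∂(Measure.pi fun _ => κ) ≤
      192 * (2 : ℝ) ^ (-(n * (p / 2))) * ∫ z, |g z| ^ p ∂κ := by
  set u := ∫ w, g w ∂κ with hu
  obtain ⟨h1, h2⟩ := integral_abs_sub_mean_rpow_le hg hp hp3 hpow
  rw [← hu] at h1 h2
  have hgi : Integrable g κ := integrable_of_abs_rpow hg (by linarith) hpow
  set ν : Measure (Fin (2 ^ n) → α) := Measure.pi fun _ => κ with hν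
  have hev : ∀ i : Fin (2 ^ n), MeasurePreserving (fun y : Fin (2 ^ n) → α => y i) ν κ :=
    fun i => measurePreserving_eval (fun _ => κ) i
  have hev' : ∀ (i : Fin (2 ^ n)) (F : α → ℝ), Measurable F →
      ∫ y, F (y i) ∂ν = ∫ z, F z ∂κ := fun i F hF => by
    rw [← (hev i).map_eq, integral_map (hev i).measurable.aemeasurable hF.aestronglyMeasurable]
  obtain ⟨h3, h4⟩ := integral_abs_sum_rpow_le (μ := ν) (Y := fun i y => g (y i) - u)
    (β := 16 * ∫ z, |g z| ^ p ∂κ) (p := p)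
    (fun i => by fun_prop) (iIndepFun_pi (X := fun _ z => g z - u) fun _ => by fun_prop) hp hp3
    (fun i => (hev i).integrable_comp_of_integrable h1)
    (fun i => by
      rw [hev' i (fun z => g z - u) (by fun_prop), integral_sub hgi (integrable_const _)]
      simp [hu])
    (fun i => by rw [hev' i (fun z => |g z - u| ^ p) (by fun_prop)]; exact h2) Finset.univ
  have e : ∀ y : Fin (2 ^ n) → α, |(∑ i, g (y i)) / 2 ^ n - u| ^ p =
      ((2 : ℝ) ^ n) ^ (-p) * |∑ i, (g (y i) - u)| ^ p := fun y => by
    have : (∑ i, g (y i)) / 2 ^ n - u = ((2 : ℝ) ^ n)⁻¹ * ∑ i, (g (y i) - u) := by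
      rw [Finset.sum_sub_distrib]
      simp only [Finset.sum_const, Finset.card_univ, Fintype.card_fin, nsmul_eq_mul]
      push_cast
      field_simp
    rw [this, abs_mul, Real.mul_rpow (abs_nonneg _) (abs_nonneg _), abs_of_pos (by positivity),
      Real.inv_rpow (by positivity), Real.rpow_neg (by positivity)]
  simp only [e]
  refine ⟨h3.const_mul _, ?_⟩
  rw [integral_const_mul]
  simp only [Finset.card_univ, Fintype.card_fin] at h4
  push_cast at h4
  have h0 : 0 ≤ ∫ z, |g z| ^ p ∂κ := integral_nonneg fun ω => by positivity
  have e2 : ((2 : ℝ) ^ n) ^ (-p) * ((2 : ℝ) ^ n) ^ (p / 2) = (2 : ℝ) ^ (-(n * (p / 2))) := by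
    rw [← Real.rpow_add (by positivity), ← Real.rpow_natCast, ← Real.rpow_mul (by norm_num)]
    congr 1; ring
  -- The factor 4p from the moment inequality and the factor 16 from centring give at most 4 · 3 ·
  -- 16 = 192, as p ≤ 3.
  calc _ ≤ ((2 : ℝ) ^ n) ^ (-p) * (4 * p * (16 * ∫ z, |g z| ^ p ∂κ) * ((2 : ℝ) ^ n) ^ (p / 2)) := by
        gcongr
    _ = (4 * p * 16) * (((2 : ℝ) ^ n) ^ (-p) * ((2 : ℝ) ^ n) ^ (p / 2)) * ∫ z, |g z| ^ p ∂κ := by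
        ring
    _ ≤ _ := by
        rw [e2]; gcongr; linarith

/-! ### Even and odd halves of a sample, and pointwise bounds for the antithetic difference -/

/-- The indices `2 i` among `2 ^ (n + 1)`. -/
def evenIdx (n : ℕ) (i : Fin (2 ^ n)) : Fin (2 ^ (n + 1)) :=
  ⟨2 * i, by have := i.2; rw [pow_succ]; omega⟩

/-- The indices `2 i + 1` among `2 ^ (n + 1)`. -/
def oddIdx (n : ℕ) (i : Fin (2 ^ n)) : Fin (2 ^ (n + 1)) :=
  ⟨2 * i + 1, by have := i.2; rw [pow_succ]; omega⟩

lemma evenIdx_injective (n : ℕ) : Function.Injective (evenIdx n) := fun i j h => by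
  simp only [evenIdx, Fin.mk.injEq] at h; ext; omega

lemma oddIdx_injective (n : ℕ) : Function.Injective (oddIdx n) := fun i j h => by
  simp only [oddIdx, Fin.mk.injEq] at h; ext; omega

lemma sum_evenIdx_add_sum_oddIdx (n : ℕ) (y : Fin (2 ^ (n + 1)) → ℝ) :
    (∑ i, y (evenIdx n i)) + ∑ i, y (oddIdx n i) = ∑ i, y i := by
  rw [← Fintype.sum_sumElim]
  refine Fintype.sum_bijective (Sum.elim (evenIdx n) (oddIdx n)) ?_ _ _ ?_
  · rw [Fintype.bijective_iff_injective_and_card]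
    refine ⟨(evenIdx_injective n).sumElim (oddIdx_injective n) fun i j h => ?_, ?_⟩
    · simp only [evenIdx, oddIdx, Fin.mk.injEq] at h; omega
    · simp [pow_succ, mul_two]
  · rintro (i | i) <;> rfl

lemma delta_succ (n : ℕ) (a : ℝ) (y : Fin (2 ^ (n + 1)) → ℝ) :
    delta (n + 1) a y = max a ((∑ i, y i) / 2 ^ (n + 1)) -
      1 / 2 * (max a ((∑ i, y (evenIdx n i)) / 2 ^ n) +
        max a ((∑ i, y (oddIdx n i)) / 2 ^ n)) := rfl

lemma delta_succ_eq (n : ℕ) (a : ℝ) (y : Fin (2 ^ (n + 1)) → ℝ) :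
    delta (n + 1) a y =
      max a (((∑ i, y (evenIdx n i)) / 2 ^ n + (∑ i, y (oddIdx n i)) / 2 ^ n) / 2) -
      1 / 2 * (max a ((∑ i, y (evenIdx n i)) / 2 ^ n) +
        max a ((∑ i, y (oddIdx n i)) / 2 ^ n)) := by
  rw [delta_succ, ← sum_evenIdx_add_sum_oddIdx, ← add_div, div_div, ← pow_succ]

/-- The midpoint is at distance |x - y|/2 from both x and y, the map max(a, ·) is 1-Lipschitz, and
|x - y|/2 is at most the larger distance to u. -/
lemma abs_max_midpoint_sub_le (a u x y : ℝ) :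
    |max a ((x + y) / 2) - 1 / 2 * (max a x + max a y)| ≤ max |x - u| |y - u| := by
  have h1 := le_max_left |x - u| |y - u|
  have h2 := le_max_right |x - u| |y - u|
  generalize max |x - u| |y - u| = M at *
  rw [abs_le] at *
  rcases max_cases a x with ⟨e1, _⟩ | ⟨e1, _⟩ <;> rcases max_cases a y with ⟨e2, _⟩ | ⟨e2, _⟩ <;>
    rcases max_cases a ((x + y) / 2) with ⟨e3, _⟩ | ⟨e3, _⟩ <;> rw [e1, e2, e3] <;>
    constructor <;> linarith [h1.1, h1.2, h2.1, h2.2]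

/-- The gain from antithetic coupling: x and y lie on the same side of the kink a as u, and max(a,
·) is affine there. -/
lemma max_midpoint_sub_eq_zero {a u x y : ℝ} (h : max |x - u| |y - u| < |u - a|) :
    max a ((x + y) / 2) - 1 / 2 * (max a x + max a y) = 0 := by
  obtain ⟨h1, h2⟩ := max_lt_iff.1 h
  rw [abs_lt] at h1 h2
  rcases le_total u a with hu | hu
  · rw [abs_of_nonpos (by linarith)] at h1 h2
    rw [max_eq_left (by linarith), max_eq_left (by linarith), max_eq_left (by linarith)]; ring
  · rw [abs_of_nonneg (by linarith)] at h1 h2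
    rw [max_eq_right (by linarith), max_eq_right (by linarith), max_eq_right (by linarith)]; ring

lemma rpow_le_of_le {q s M : ℝ} (hqp : q ≤ p) (hs : 0 < s) (hM : s ≤ M) :
    M ^ q ≤ s ^ (q - p) * M ^ p := by
  have h1 : M ^ (q - p) ≤ s ^ (q - p) := Real.rpow_le_rpow_of_nonpos hs hM (by linarith)
  have hM0 : 0 < M := hs.trans_le hM
  calc M ^ q = M ^ (q - p) * M ^ p := by rw [← Real.rpow_add hM0]; congr 1; ring
    _ ≤ _ := by gcongr

/-- To be read with t the absolute difference, M the larger deviation of the half averages and D =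
|u - a|. If M < D, then t = 0. If D ≥ ε, then M ≥ ε may be assumed and M^q ≤ ε^(q-p) M^p. If D < ε,
truncation at s gives either M^q ≤ s^(q-p) M^p or M^q ≤ s^q, and the last bound is paid only on the
event D < ε. -/
lemma rpow_le_add_indicator {q s ε t M D : ℝ} (hq : 0 < q) (hqp : q ≤ p) (hs : 0 < s) (hε : 0 < ε)
    (ht : 0 ≤ t) (htM : t ≤ M) (hD : M < D → t = 0) :
    t ^ q ≤ (s ^ (q - p) + ε ^ (q - p)) * M ^ p + (Set.Iio ε).indicator (fun _ => s ^ q) D := by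
  have hM0 : 0 ≤ M := ht.trans htM
  have h0 : 0 ≤ (Set.Iio ε).indicator (fun _ => s ^ q) D :=
    Set.indicator_nonneg (fun _ _ => by positivity) _
  have htq : t ^ q ≤ M ^ q := Real.rpow_le_rpow ht htM hq.le
  have h1 : 0 ≤ s ^ (q - p) * M ^ p := by positivity
  have h2 : 0 ≤ ε ^ (q - p) * M ^ p := by positivity
  rw [add_mul]
  rcases lt_or_ge M D with h | h
  · rw [hD h, Real.zero_rpow hq.ne']; positivity
  rcases lt_or_ge D ε with hDε | hDε
  · rw [Set.indicator_of_mem (by exact hDε)]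
    rcases le_total s M with hsM | hsM
    · have := rpow_le_of_le hqp hs hsM
      have : 0 ≤ s ^ q := by positivity
      linarith
    · have := Real.rpow_le_rpow hM0 hsM hq.le
      linarith
  · have := rpow_le_of_le hqp hε (hDε.trans h)
    linarith

/-- The conditional moment bound for the antithetic differences: `u` is the mean of one copy. -/
lemma lintegral_abs_delta_rpow_le (hg : Measurable g) (hp : 2 < p) (hp3 : p ≤ 3) {q s ε : ℝ}
    (hq : 0 < q) (hqp : q ≤ p) (hs : 0 < s) (hε : 0 < ε) (n : ℕ) (a : ℝ) :
    ∫⁻ y : Fin (2 ^ (n + 1)) → α, ENNReal.ofReal (|delta (n + 1) a fun i => g (y i)| ^ q)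
        ∂(Measure.pi fun _ => κ) ≤
      ENNReal.ofReal ((s ^ (q - p) + ε ^ (q - p)) * (384 * (2 : ℝ) ^ (-(n * (p / 2))))) *
        ∫⁻ z, ENNReal.ofReal (|g z| ^ p) ∂κ +
      (Set.Iio ε).indicator (fun _ => ENNReal.ofReal (s ^ q)) |(∫ z, g z ∂κ) - a| := by
  -- With an infinite p-th moment the right-hand side is `⊤`, since its coefficient is positive; no
  -- integrability hypothesis is needed.
  by_cases hfin : ∫⁻ z, ENNReal.ofReal (|g z| ^ p) ∂κ = ⊤
  · rw [hfin, ENNReal.mul_top (by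
      rw [ne_eq, ENNReal.ofReal_eq_zero, not_le]; positivity), top_add]
    exact le_top
  have hpow : Integrable (fun z => |g z| ^ p) κ := by
    refine ⟨Measurable.aestronglyMeasurable (by fun_prop), ?_⟩
    rw [hasFiniteIntegral_iff_ofReal (ae_of_all _ fun z => by positivity)]
    exact lt_top_iff_ne_top.2 hfin
  rw [← ofReal_integral_eq_lintegral_ofReal hpow (ae_of_all _ fun z => by positivity),
    ← ENNReal.ofReal_mul (by positivity)]
  set u := ∫ z, g z ∂κ with hu
  obtain ⟨i1, b1⟩ := integral_abs_average_sub_rpow_le hg hp hp3 hpow n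
  rw [← hu] at i1 b1
  set B := ∫ z, |g z| ^ p ∂κ
  have hB : 0 ≤ B := integral_nonneg fun ω => by positivity
  -- Each half contributes the constant 192, whence 384 in the statement.
  have key : ∀ e : Fin (2 ^ n) → Fin (2 ^ (n + 1)), Function.Injective e →
      ∫⁻ y : Fin (2 ^ (n + 1)) → α, ENNReal.ofReal (|(∑ i, g (y (e i))) / 2 ^ n - u| ^ p)
        ∂(Measure.pi fun _ => κ) ≤ ENNReal.ofReal (192 * (2 : ℝ) ^ (-(n * (p / 2))) * B) := by
    intro e he
    have := (measurePreserving_pi_comp κ he).lintegral_comp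
      (f := fun y : Fin (2 ^ n) → α => ENNReal.ofReal (|(∑ i, g (y i)) / 2 ^ n - u| ^ p))
      (by fun_prop)
    rw [this, ← ofReal_integral_eq_lintegral_ofReal i1 (ae_of_all _ fun z => by positivity)]
    exact ENNReal.ofReal_le_ofReal b1
  have hc : 0 ≤ s ^ (q - p) + ε ^ (q - p) := by positivity
  have hpt : ∀ y : Fin (2 ^ (n + 1)) → α,
      ENNReal.ofReal (|delta (n + 1) a fun i => g (y i)| ^ q) ≤
      ENNReal.ofReal (s ^ (q - p) + ε ^ (q - p)) *
        (ENNReal.ofReal (|(∑ i, g (y (evenIdx n i))) / 2 ^ n - u| ^ p) +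
          ENNReal.ofReal (|(∑ i, g (y (oddIdx n i))) / 2 ^ n - u| ^ p)) +
        (Set.Iio ε).indicator (fun _ => ENNReal.ofReal (s ^ q)) |u - a| := by
    intro y
    rw [delta_succ_eq]
    set x := (∑ i, g (y (evenIdx n i))) / 2 ^ n
    set x' := (∑ i, g (y (oddIdx n i))) / 2 ^ n
    have h1 := rpow_le_add_indicator (p := p) (D := |u - a|) hq hqp hs hε (abs_nonneg _)
      (abs_max_midpoint_sub_le a u x x') fun h => by rw [max_midpoint_sub_eq_zero h, abs_zero]
    have h2 : max |x - u| |x' - u| ^ p ≤ |x - u| ^ p + |x' - u| ^ p := by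
      rcases max_choice |x - u| |x' - u| with h | h <;> rw [h]
      · have := Real.rpow_nonneg (abs_nonneg (x' - u)) p; linarith
      · have := Real.rpow_nonneg (abs_nonneg (x - u)) p; linarith
    have h3 : (Set.Iio ε).indicator (fun _ => ENNReal.ofReal (s ^ q)) |u - a| =
        ENNReal.ofReal ((Set.Iio ε).indicator (fun _ => s ^ q) |u - a|) := by
      by_cases h : |u - a| ∈ Set.Iio ε <;> simp [h]
    rw [h3, ← ENNReal.ofReal_add (by positivity) (by positivity), ← ENNReal.ofReal_mul hc,
      ← ENNReal.ofReal_add (by positivity) (Set.indicator_nonneg (fun _ _ => by positivity) _)]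
    refine ENNReal.ofReal_le_ofReal (h1.trans ?_)
    gcongr
  refine (lintegral_mono hpt).trans ?_
  rw [lintegral_add_right _ measurable_const, lintegral_const_mul _ (by fun_prop),
    lintegral_add_left (by fun_prop), lintegral_const, measure_univ, mul_one]
  gcongr
  refine (mul_le_mul_right (add_le_add (key _ (evenIdx_injective n))
    (key _ (oddIdx_injective n))) _).trans ?_
  rw [← ENNReal.ofReal_add (by positivity) (by positivity), ← ENNReal.ofReal_mul hc]
  exact ENNReal.ofReal_le_ofReal (le_of_eq (by ring))

/-! ### Telescoping of the expected antithetic differences -/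

/-- The mean of the maximum of `a` and an average of `2 ^ n` independent copies. -/
def meanMax (κ : Measure α) (g : α → ℝ) (a : ℝ) (n : ℕ) : ℝ :=
  ∫ y : Fin (2 ^ n) → α, max a ((∑ i, g (y i)) / 2 ^ n) ∂(Measure.pi fun _ => κ)

lemma integrable_max_average (hgi : Integrable g κ) (a : ℝ) (n : ℕ) :
    Integrable (fun y : Fin (2 ^ n) → α => max a ((∑ i, g (y i)) / 2 ^ n))
      (Measure.pi fun _ => κ) := by
  refine (integrable_const a).sup (Integrable.div_const (integrable_finsetSum _ fun i _ => ?_) _)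
  exact (measurePreserving_eval (fun _ => κ) i).integrable_comp_of_integrable hgi

lemma integral_delta_zero (ν : Measure α) (a : ℝ) :
    ∫ y : Fin (2 ^ 0) → α, delta 0 a (fun i => g (y i)) ∂(Measure.pi fun _ => ν) =
      meanMax ν g a 0 := by
  refine integral_congr_ae (ae_of_all _ fun y => ?_)
  change max a (g (y 0)) = max a ((∑ i : Fin 1, g (y i)) / 2 ^ 0)
  simp

/-- Both half averages have the law of the average of the previous level, so the two subtracted
terms have the same mean. -/
lemma integral_delta_succ (hg : Measurable g) (hgi : Integrable g κ) (a : ℝ) (n : ℕ) :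
    ∫ y : Fin (2 ^ (n + 1)) → α, delta (n + 1) a (fun i => g (y i)) ∂(Measure.pi fun _ => κ) =
      meanMax κ g a (n + 1) - meanMax κ g a n := by
  have key : ∀ e : Fin (2 ^ n) → Fin (2 ^ (n + 1)), Function.Injective e →
      Integrable (fun y : Fin (2 ^ (n + 1)) → α => max a ((∑ i, g (y (e i))) / 2 ^ n))
        (Measure.pi fun _ => κ) ∧
      ∫ y : Fin (2 ^ (n + 1)) → α, max a ((∑ i, g (y (e i))) / 2 ^ n) ∂(Measure.pi fun _ => κ) =
        meanMax κ g a n := by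
    intro e he
    have hm := measurePreserving_pi_comp κ he
    refine ⟨hm.integrable_comp_of_integrable (integrable_max_average hgi a n), ?_⟩
    rw [meanMax, ← hm.map_eq, integral_map hm.measurable.aemeasurable
      (Measurable.aestronglyMeasurable (by fun_prop))]
  obtain ⟨i1, e1⟩ := key _ (evenIdx_injective n)
  obtain ⟨i2, e2⟩ := key _ (oddIdx_injective n)
  have i3 : Integrable (fun y : Fin (2 ^ (n + 1)) → α =>
      max a ((∑ i, g (y (evenIdx n i))) / 2 ^ n) + max a ((∑ i, g (y (oddIdx n i))) / 2 ^ n))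
      (Measure.pi fun _ => κ) := i1.add i2
  simp only [delta_succ]
  rw [integral_sub (integrable_max_average hgi a (n + 1)) (i3.const_mul _),
    integral_const_mul, integral_add i1 i2, e1, e2]
  change meanMax κ g a (n + 1) - _ = _
  ring

open Filter Topology in
-- Since max(a, ·) is 1-Lipschitz, the error is at most the mean absolute deviation of the average,
-- hence at most its p-th root moment, which decays geometrically.
lemma tendsto_meanMax (hg : Measurable g) (hp : 2 < p) (hp3 : p ≤ 3)
    (hpow : Integrable (fun z => |g z| ^ p) κ) (a : ℝ) :
    Tendsto (meanMax κ g a) atTop (𝓝 (max a (∫ z, g z ∂κ))) := by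
  have hgi : Integrable g κ := integrable_of_abs_rpow hg (by linarith) hpow
  set u := ∫ z, g z ∂κ with hu
  set B := ∫ z, |g z| ^ p ∂κ with hB
  have hB0 : 0 ≤ B := integral_nonneg fun ω => by positivity
  have hbd : ∀ n, dist (meanMax κ g a n) (max a u) ≤
      (192 * B * ((2 : ℝ) ^ (-(p / 2))) ^ n) ^ (1 / p) := by
    intro n
    obtain ⟨i1, b1⟩ := integral_abs_average_sub_rpow_le hg hp hp3 hpow n
    rw [← hu] at i1 b1
    have hmm : Measurable fun y : Fin (2 ^ n) → α => (∑ i, g (y i)) / 2 ^ n - u := by fun_prop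
    have i2 := integrable_of_abs_rpow hmm (by linarith) i1
    have h1 := integral_abs_rpow_le (q := 1) one_pos (by linarith) hmm.aestronglyMeasurable i1
    simp only [Real.rpow_one] at h1
    rw [Real.dist_eq, meanMax]
    have e : max a u = ∫ _ : Fin (2 ^ n) → α, max a u ∂(Measure.pi fun _ => κ) := by simp
    rw [e, ← integral_sub (integrable_max_average hgi a n) (integrable_const _)]
    calc _ ≤ ∫ y : Fin (2 ^ n) → α, |max a ((∑ i, g (y i)) / 2 ^ n) - max a u|
          ∂(Measure.pi fun _ => κ) := abs_integral_le_integral_abs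
      _ ≤ ∫ y : Fin (2 ^ n) → α, |(∑ i, g (y i)) / 2 ^ n - u| ∂(Measure.pi fun _ => κ) := by
        refine integral_mono
          ((integrable_max_average hgi a n).sub (integrable_const _)).abs i2.abs fun y => ?_
        exact abs_max_sub_max_le_max a _ a u |>.trans (by simp)
      _ ≤ _ := h1.trans (Real.rpow_le_rpow (integral_nonneg fun ω => by positivity)
        (b1.trans (le_of_eq ?_)) (by positivity))
    rw [← Real.rpow_natCast, ← Real.rpow_mul (by norm_num), ← hB]
    rw [show -(p / 2) * (n : ℝ) = -(n * (p / 2)) by ring]; ring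
  refine tendsto_iff_dist_tendsto_zero.2 (squeeze_zero (fun _ => dist_nonneg) hbd ?_)
  have h2 : (2 : ℝ) ^ (-(p / 2)) < 1 := Real.rpow_lt_one_of_one_lt_of_neg one_lt_two (by linarith)
  have h3 := ((tendsto_pow_atTop_nhds_zero_of_lt_one (by positivity) h2).const_mul
    (192 * B)).rpow_const (p := 1 / p) (Or.inr (by positivity))
  rwa [mul_zero, Real.zero_rpow (by positivity)] at h3

/-- If the expected antithetic differences are summable, then their sum is `max a u`. -/
lemma hasSum_integral_delta (hg : Measurable g) (hp : 2 < p) (hp3 : p ≤ 3)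
    (hpow : Integrable (fun z => |g z| ^ p) κ) (a : ℝ)
    (hsum : Summable fun n => ∫ y : Fin (2 ^ n) → α, delta n a (fun i => g (y i))
      ∂(Measure.pi fun _ => κ)) :
    HasSum (fun n => ∫ y : Fin (2 ^ n) → α, delta n a (fun i => g (y i))
      ∂(Measure.pi fun _ => κ)) (max a (∫ z, g z ∂κ)) := by
  have hgi : Integrable g κ := integrable_of_abs_rpow hg (by linarith) hpow
  have h1 : ∀ n, ∑ j ∈ Finset.range (n + 1), ∫ y : Fin (2 ^ j) → α, delta j a (fun i => g (y i))
      ∂(Measure.pi fun _ => κ) = meanMax κ g a n := by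
    intro n
    induction n with
    | zero => 
      simp only [zero_add, Finset.range_one, Finset.sum_singleton]
      exact integral_delta_zero κ a
    | succ n ih => rw [Finset.sum_range_succ, ih, integral_delta_succ hg hgi]; ring
  have h2 := (Filter.tendsto_add_atTop_iff_nat 1).2 hsum.hasSum.tendsto_sum_nat
  simp only [h1] at h2
  rw [← tendsto_nhds_unique h2 (tendsto_meanMax hg hp hp3 hpow a)]
  exact hsum.hasSum

end Delta

/-! ### Backward induction -/

/-- The value of continuing optimally with `m + 1` observations to come, by backward induction. -/
def contValue (π : (k : ℕ) → Kernel (Fin k → 𝒳) 𝒳) (f : 𝒳 → ℝ) :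
    (m k : ℕ) → (Fin k → 𝒳) → ℝ
  | 0, k, h => ∫ x, f x ∂π k h
  | m + 1, k, h => ∫ x, max (f x) (contValue π f m (k + 1) (extend (h, x))) ∂π k h

/-- The Snell envelope at the history `h`, with `m` observations to come. -/
def snell (π : (k : ℕ) → Kernel (Fin k → 𝒳) 𝒳) (f : 𝒳 → ℝ) :
    (m k : ℕ) → (Fin (k + 1) → 𝒳) → ℝ
  | 0, k, h => f (h (Fin.last k))
  | m + 1, k, h => max (f (h (Fin.last k))) (contValue π f m (k + 1) h)

/-- The expected sum of the absolute values of the next `m` rewards. -/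
def absRewards (π : (k : ℕ) → Kernel (Fin k → 𝒳) 𝒳) (f : 𝒳 → ℝ) :
    (m k : ℕ) → (Fin k → 𝒳) → ENNReal
  | 0, _, _ => 0
  | m + 1, k, h => ∫⁻ x, ‖f x‖ₑ + absRewards π f m (k + 1) (extend (h, x)) ∂π k h

section Values

variable (π : (k : ℕ) → Kernel (Fin k → 𝒳) 𝒳) {f : 𝒳 → ℝ}

lemma contValue_eq (f : 𝒳 → ℝ) (m k : ℕ) (h : Fin k → 𝒳) :
    contValue π f m k h = ∫ x, snell π f m k (extend (h, x)) ∂π k h := by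
  cases m <;> simp [contValue, snell]

/-- The bound on the value of continuing is a hypothesis, so that the lemma can serve inside the
induction that proves this bound and again afterwards. -/
lemma enorm_snell_le_of (f : 𝒳 → ℝ) (m k : ℕ) (h : Fin (k + 1) → 𝒳)
    (hc : ∀ m', m = m' + 1 → ‖contValue π f m' (k + 1) h‖ₑ ≤ absRewards π f m (k + 1) h) :
    ‖snell π f m k h‖ₑ ≤ ‖f (h (Fin.last k))‖ₑ + absRewards π f m (k + 1) h := by
  cases m with
  | zero => simp [snell, absRewards]
  | succ m =>
    rw [snell]
    rcases max_choice (f (h (Fin.last k))) (contValue π f m (k + 1) h) with e | e <;> rw [e]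
    · exact le_self_add
    · exact (hc m rfl).trans le_add_self

lemma enorm_contValue_le (f : 𝒳 → ℝ) (m k : ℕ) (h : Fin k → 𝒳) :
    ‖contValue π f m k h‖ₑ ≤ absRewards π f (m + 1) k h := by
  induction m generalizing k with
  | zero =>
    rw [contValue_eq]
    refine (enorm_integral_le_lintegral_enorm _).trans (lintegral_mono fun x => ?_)
    simpa using enorm_snell_le_of π f 0 k (extend (h, x)) (by simp)
  | succ m ih =>
    rw [contValue_eq]
    refine (enorm_integral_le_lintegral_enorm _).trans (lintegral_mono fun x => ?_)
    simpa using enorm_snell_le_of π f (m + 1) k (extend (h, x)) fun m' hm => by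
      obtain rfl := Nat.succ_injective hm; exact ih _ _

lemma enorm_snell_le (f : 𝒳 → ℝ) (m k : ℕ) (h : Fin (k + 1) → 𝒳) :
    ‖snell π f m k h‖ₑ ≤ ‖f (h (Fin.last k))‖ₑ + absRewards π f m (k + 1) h :=
  enorm_snell_le_of π f m k h fun m' hm => by subst hm; exact enorm_contValue_le π f m' _ h

variable [∀ k, IsMarkovKernel (π k)]

lemma measurable_contValue (hf : Measurable f) (m k : ℕ) : Measurable (contValue π f m k) := by
  induction m generalizing k with
  | zero =>
    exact (StronglyMeasurable.integral_kernel (κ := π k) hf.stronglyMeasurable).measurable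
  | succ m ih =>
    refine (StronglyMeasurable.integral_kernel_prod_right (κ := π k) (f := fun h x =>
      max (f x) (contValue π f m (k + 1) (extend (h, x)))) ?_).measurable
    exact ((hf.comp measurable_snd).max ((ih (k + 1)).comp measurable_extend)).stronglyMeasurable

lemma measurable_snell (hf : Measurable f) (m k : ℕ) : Measurable (snell π f m k) := by
  cases m with
  | zero => exact hf.comp (measurable_pi_apply _)
  | succ m =>
    exact (hf.comp (measurable_pi_apply _)).max (measurable_contValue π hf m (k + 1))

lemma measurable_absRewards (hf : Measurable f) (m k : ℕ) : Measurable (absRewards π f m k) := by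
  induction m generalizing k with
  | zero => exact measurable_const
  | succ m ih =>
    refine Measurable.lintegral_kernel_prod_right (κ := π k) (f := fun h x =>
      ‖f x‖ₑ + absRewards π f m (k + 1) (extend (h, x))) ?_
    exact (hf.comp measurable_snd).enorm.add ((ih (k + 1)).comp measurable_extend)

lemma integrable_snell (hf : Measurable f) {m k : ℕ} {h : Fin k → 𝒳}
    (hG : absRewards π f (m + 1) k h ≠ ⊤) :
    Integrable (fun x => snell π f m k (extend (h, x))) (π k h) := by
  refine ⟨((measurable_snell π hf m k).comp
    (measurable_extend.comp measurable_prodMk_left)).aestronglyMeasurable, ?_⟩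
  refine lt_of_le_of_lt (lintegral_mono fun x => ?_) (lt_top_iff_ne_top.2 hG)
  simpa using enorm_snell_le π f m k (extend (h, x))

end Values

/-! ### The conditional law of the future -/

lemma measurable_prepend {m : ℕ} : Measurable (prepend (𝒳 := 𝒳) (m := m)) := by
  refine measurable_pi_iff.2 fun i => ?_
  refine Fin.cases ?_ (fun j => ?_) i
  · simpa [prepend] using measurable_fst
  · simp only [prepend, Fin.cons_succ]
    fun_prop

@[simp] lemma prepend_zero {E : Type*} {m : ℕ} (x : E) (y : Fin m → E) : prepend (x, y) 0 = x := rfl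

@[simp] lemma prepend_succ {E : Type*} {m : ℕ} (x : E) (y : Fin m → E) (i : Fin m) :
    prepend (x, y) i.succ = y i := rfl

section Tail

variable (π : (k : ℕ) → Kernel (Fin k → 𝒳) 𝒳) {f : 𝒳 → ℝ} [∀ k, IsMarkovKernel (π k)]

instance isMarkovKernel_tailLaw (m k : ℕ) : IsMarkovKernel (tailLaw π m k) := by
  induction m generalizing k with
  | zero => rw [tailLaw]; infer_instance
  | succ m ih =>
    have := ih (k + 1)
    rw [tailLaw]
    exact Kernel.IsMarkovKernel.map _ measurable_prepend

lemma lintegral_tailLaw_succ (m k : ℕ) (h : Fin k → 𝒳) {F : (Fin (m + 1) → 𝒳) → ENNReal}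
    (hF : Measurable F) :
    ∫⁻ y, F y ∂tailLaw π (m + 1) k h =
      ∫⁻ x, ∫⁻ y, F (prepend (x, y)) ∂tailLaw π m (k + 1) (extend (h, x)) ∂π k h := by
  rw [tailLaw, Kernel.lintegral_map _ measurable_prepend _ hF]
  exact Kernel.lintegral_compProd _ _ _ (hF.comp measurable_prepend)

lemma integral_tailLaw_succ (m k : ℕ) (h : Fin k → 𝒳) {F : (Fin (m + 1) → 𝒳) → ℝ}
    (hF : Measurable F) (hFi : Integrable F (tailLaw π (m + 1) k h)) :
    Integrable (fun x => ∫ y, F (prepend (x, y)) ∂tailLaw π m (k + 1) (extend (h, x))) (π k h) ∧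
    ∫ y, F y ∂tailLaw π (m + 1) k h =
      ∫ x, ∫ y, F (prepend (x, y)) ∂tailLaw π m (k + 1) (extend (h, x)) ∂π k h := by
  rw [tailLaw, Kernel.map_apply _ measurable_prepend] at hFi ⊢
  have h1 := (integrable_map_measure hF.aestronglyMeasurable measurable_prepend.aemeasurable).1 hFi
  rw [integral_map measurable_prepend.aemeasurable hF.aestronglyMeasurable]
  exact ⟨h1.integral_compProd, integral_compProd h1⟩

/-- Finiteness of `absRewards` at a history thus makes every stopped reward integrable under the
conditional law of the future. -/
lemma lintegral_tailLaw_le (hf : Measurable f) (m k : ℕ) (h : Fin k → 𝒳) (i : Fin m) :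
    ∫⁻ y, ‖f (y i)‖ₑ ∂tailLaw π m k h ≤ absRewards π f m k h := by
  induction m generalizing k with
  | zero => exact i.elim0
  | succ m ih =>
    rw [lintegral_tailLaw_succ _ _ _ _ (by fun_prop)]
    refine lintegral_mono fun x => ?_
    cases i using Fin.cases with
    | zero => simp
    | succ i => simpa using (ih (k + 1) (extend (h, x)) i).trans le_add_self

lemma measurable_stopped (hf : Measurable f) {m : ℕ} {τ : (Fin m → 𝒳) → Fin m}
    (hτ : Measurable τ) : Measurable fun y : Fin m → 𝒳 => f (y (τ y)) := by
  have h1 : Measurable fun q : Fin m × (Fin m → 𝒳) => f (q.2 q.1) :=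
    measurable_from_prod_countable_right fun i => hf.comp (measurable_pi_apply i)
  exact h1.comp (hτ.prodMk measurable_id)

lemma integrable_stopped (hf : Measurable f) {m k : ℕ} {h : Fin k → 𝒳}
    (hG : absRewards π f m k h ≠ ⊤) {τ : (Fin m → 𝒳) → Fin m} (hτ : Measurable τ) :
    Integrable (fun y => f (y (τ y))) (tailLaw π m k h) := by
  refine ⟨(measurable_stopped hf hτ).aestronglyMeasurable, ?_⟩
  refine lt_of_le_of_lt (lintegral_mono (g := fun y => ∑ i, ‖f (y i)‖ₑ) fun y =>
    Finset.single_le_sum (f := fun i => ‖f (y i)‖ₑ) (fun _ _ => zero_le) (Finset.mem_univ (τ y))) ?_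
  rw [lintegral_finsetSum _ (by fun_prop)]
  exact ENNReal.sum_lt_top.2 fun i _ =>
    (lintegral_tailLaw_le π hf m k h i).trans_lt (lt_top_iff_ne_top.2 hG)

end Tail

/-! ### Stopping the coordinate process -/

/-- Stopping times of the coordinate process: the decision to stop depends on the observations up
to that time only. -/
def IsCoordStop {m : ℕ} (τ : (Fin m → 𝒳) → Fin m) : Prop :=
  Measurable τ ∧ ∀ y y' : Fin m → 𝒳, (∀ j ≤ τ y, y j = y' j) → τ y' = τ y

section CoordStop

/-- A Galmarino-type test. A measurable set that depends only on the coordinates up to i is the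
pullback of its preimage under the map that pads a truncated path with a fixed point; the padding is
why the space must be nonempty. -/
lemma measurableSet_natural_iff [TopologicalSpace 𝒳] [TopologicalSpace.MetrizableSpace 𝒳]
    [BorelSpace 𝒳] [Nonempty 𝒳] {m : ℕ}
    (hZ : ∀ i : Fin m, StronglyMeasurable fun y : Fin m → 𝒳 => y i) (i : Fin m)
    (S : Set (Fin m → 𝒳)) :
    MeasurableSet[Filtration.natural (fun (i : Fin m) (y : Fin m → 𝒳) => y i) hZ i] S ↔
      MeasurableSet S ∧ ∀ y y' : Fin m → 𝒳, (∀ j ≤ i, y j = y' j) → y ∈ S → y' ∈ S := by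
  classical
  constructor
  · intro hS
    refine ⟨(Filtration.natural _ hZ).le i S hS, ?_⟩
    rw [Filtration.natural_eq_comap] at hS
    obtain ⟨B, _, rfl⟩ := hS
    intro y y' hyy hy
    have : (fun j : Set.Iic i => y' j) = fun j : Set.Iic i => y j :=
      funext fun j => (hyy j j.2).symm
    simpa only [Set.mem_preimage, this] using hy
  · rintro ⟨hS, hloc⟩
    rw [Filtration.natural_eq_comap]
    let x₀ : 𝒳 := Classical.arbitrary 𝒳
    let e : (Set.Iic i → 𝒳) → Fin m → 𝒳 := fun z j => if hj : j ≤ i then z ⟨j, hj⟩ else x₀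
    have he : Measurable e := by
      refine measurable_pi_iff.2 fun j => ?_
      by_cases hj : j ≤ i
      · simpa only [e, hj, dif_pos] using measurable_pi_apply _
      · simp only [e, hj, dif_neg, not_false_eq_true]; exact measurable_const
    refine ⟨e ⁻¹' S, he hS, ?_⟩
    ext y
    have h1 : ∀ j ≤ i, e (fun j : Set.Iic i => y j) j = y j := fun j hj => by
      simp [e, hj]
    exact ⟨hloc _ _ h1, hloc _ _ fun j hj => (h1 j hj).symm⟩

lemma isStoppingTime_iff_isCoordStop [TopologicalSpace 𝒳] [TopologicalSpace.MetrizableSpace 𝒳]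
    [BorelSpace 𝒳] [Nonempty 𝒳] {m : ℕ}
    (hZ : ∀ i : Fin m, StronglyMeasurable fun y : Fin m → 𝒳 => y i)
    (τ : (Fin m → 𝒳) → Fin m) :
    IsStoppingTime (Filtration.natural (fun (i : Fin m) (y : Fin m → 𝒳) => y i) hZ)
      (fun y => (τ y : WithTop (Fin m))) ↔ IsCoordStop τ := by
  simp only [IsStoppingTime, measurableSet_natural_iff, WithTop.coe_le_coe, Set.mem_ofPred_eq]
  constructor
  · intro h
    refine ⟨measurable_of_Iic fun i => (h i).1, fun y y' hy => ?_⟩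
    -- The event {τ ≤ τ y} depends only on coordinates on which y and y' agree. As τ y' ≤ τ y, the
    -- paths also agree up to τ y', and the argument can be reversed.
    have h1 : τ y' ≤ τ y := (h (τ y)).2 y y' hy le_rfl
    exact h1.antisymm ((h (τ y')).2 y' y (fun j hj => (hy j (hj.trans h1)).symm) le_rfl)
  · rintro ⟨h1, h2⟩ i
    refine ⟨h1 measurableSet_Iic, fun y y' hy hi => ?_⟩
    rw [h2 y y' fun j hj => hy j (hj.trans hi)]
    exact hi

/-- Stopping at once is decided by the first observation alone, so for fixed x it happens either for
all continuations or for none. In the second case `IsCoordStop.section_succ` supplies a stopping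
time of the remaining path. -/
lemma IsCoordStop.section_zero {m : ℕ} {τ : (Fin (m + 1) → 𝒳) → Fin (m + 1)}
    (hτ : IsCoordStop τ) {x : 𝒳} {y₀ : Fin m → 𝒳} (h : τ (prepend (x, y₀)) = 0) (y : Fin m → 𝒳) :
    τ (prepend (x, y)) = 0 := by
  rw [hτ.2 (prepend (x, y₀)) (prepend (x, y)), h]
  intro j hj
  rw [h, Fin.le_zero_iff] at hj
  subst hj; rfl

lemma IsCoordStop.section_succ {m : ℕ} {τ : (Fin (m + 2) → 𝒳) → Fin (m + 2)}
    (hτ : IsCoordStop τ) {x : 𝒳} (h : ∀ y, τ (prepend (x, y)) ≠ 0) :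
    ∃ σ : (Fin (m + 1) → 𝒳) → Fin (m + 1), IsCoordStop σ ∧
      ∀ y, τ (prepend (x, y)) = (σ y).succ := by
  choose σ hσ using fun y => Fin.exists_succ_eq_of_ne_zero (h y)
  refine ⟨σ, ⟨?_, fun y y' hy => ?_⟩, fun y => (hσ y).symm⟩
  · have h1 : Measurable fun y : Fin (m + 1) → 𝒳 => τ (prepend (x, y)) :=
      hτ.1.comp (measurable_prepend.comp measurable_prodMk_left)
    have h2 : σ = (fun i : Fin (m + 2) => if hi : i = 0 then 0 else i.pred hi) ∘
        fun y => τ (prepend (x, y)) := by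
      ext1 y
      simp [← hσ y]
    rw [h2]
    exact Measurable.of_discrete.comp h1
  · apply Fin.succ_injective
    rw [hσ, hσ]
    apply hτ.2
    intro j hj
    cases j using Fin.cases with
    | zero => rfl
    | succ j =>
      rw [← hσ, Fin.succ_le_succ_iff] at hj
      exact hy j hj

end CoordStop

/-! ### Optimal stopping under the conditional law of the future -/

section Utility

variable (π : (k : ℕ) → Kernel (Fin k → 𝒳) 𝒳) {f : 𝒳 → ℝ}

/-- The first time at which stopping is optimal. -/
def optimalStop (π : (k : ℕ) → Kernel (Fin k → 𝒳) 𝒳) (f : 𝒳 → ℝ) :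
    (m k : ℕ) → (Fin k → 𝒳) → (Fin (m + 1) → 𝒳) → Fin (m + 1)
  | 0, _, _, _ => 0
  | m + 1, k, h, y =>
    open Classical in
    if contValue π f m (k + 1) (extend (h, y 0)) ≤ f (y 0) then 0
    else (optimalStop π f m (k + 1) (extend (h, y 0)) (Fin.tail y)).succ

lemma optimalStop_prepend_of_le {m k : ℕ} {h : Fin k → 𝒳} {x : 𝒳}
    (hc : contValue π f m (k + 1) (extend (h, x)) ≤ f x) (y : Fin (m + 1) → 𝒳) :
    optimalStop π f (m + 1) k h (prepend (x, y)) = 0 := if_pos hc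

lemma optimalStop_prepend_of_lt {m k : ℕ} {h : Fin k → 𝒳} {x : 𝒳}
    (hc : ¬contValue π f m (k + 1) (extend (h, x)) ≤ f x) (y : Fin (m + 1) → 𝒳) :
    optimalStop π f (m + 1) k h (prepend (x, y)) =
      (optimalStop π f m (k + 1) (extend (h, x)) y).succ := if_neg hc

variable [∀ k, IsMarkovKernel (π k)]

lemma ae_absRewards_ne_top (hf : Measurable f) {m k : ℕ} {h : Fin k → 𝒳}
    (hG : absRewards π f (m + 1) k h ≠ ⊤) :
    ∀ᵐ x ∂π k h, absRewards π f m (k + 1) (extend (h, x)) ≠ ⊤ := by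
  rw [absRewards, lintegral_add_left (by fun_prop)] at hG
  filter_upwards [ae_lt_top ((measurable_absRewards π hf m (k + 1)).comp
    (measurable_extend.comp measurable_prodMk_left)) (ne_top_of_le_ne_top hG le_add_self)]
    with x hx using hx.ne

/-- Condition on the next observation x. If τ stops there, the reward is f(x); otherwise the shifted
stopping time earns at most the next value of continuing. Either is at most the Snell envelope,
whose mean is the present value of continuing. -/
lemma integral_stopped_le (hf : Measurable f) (m k : ℕ) (h : Fin k → 𝒳)
    (hG : absRewards π f (m + 1) k h ≠ ⊤) {τ : (Fin (m + 1) → 𝒳) → Fin (m + 1)}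
    (hτ : IsCoordStop τ) :
    ∫ y, f (y (τ y)) ∂tailLaw π (m + 1) k h ≤ contValue π f m k h := by
  induction m generalizing k with
  | zero =>
    obtain ⟨i1, e1⟩ := integral_tailLaw_succ π 0 k h (measurable_stopped hf hτ.1)
      (integrable_stopped π hf hG hτ.1)
    have e2 : ∀ x y, f (prepend (x, y) (τ (prepend (x, y)))) = f x := fun x y => by
      rw [show τ (prepend (x, y)) = 0 from Subsingleton.elim (α := Fin 1) _ _]; rfl
    simp [e1, e2, contValue]
  | succ m ih =>
    obtain ⟨i1, e1⟩ := integral_tailLaw_succ π (m + 1) k h (measurable_stopped hf hτ.1)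
      (integrable_stopped π hf hG hτ.1)
    rw [e1, contValue_eq]
    refine integral_mono_ae i1 (integrable_snell π hf hG) ?_
    filter_upwards [ae_absRewards_ne_top π hf hG] with x hx
    rw [snell, extend_last]
    by_cases h0 : ∃ y, τ (prepend (x, y)) = 0
    · obtain ⟨y₀, hy₀⟩ := h0
      simp [hτ.section_zero hy₀]
    · push Not at h0
      obtain ⟨σ, hσ, e⟩ := hτ.section_succ h0
      simp only [e, prepend_succ]
      exact (ih (k + 1) _ hx hσ).trans (le_max_right _ _)

lemma measurable_optimalStop (hf : Measurable f) (m k : ℕ) :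
    Measurable fun q : (Fin k → 𝒳) × (Fin (m + 1) → 𝒳) => optimalStop π f m k q.1 q.2 := by
  induction m generalizing k with
  | zero => exact measurable_const
  | succ m ih =>
    simp only [optimalStop]
    have h1 : Measurable fun q : (Fin k → 𝒳) × (Fin (m + 2) → 𝒳) => extend (q.1, q.2 0) :=
      measurable_extend.comp (by fun_prop)
    refine Measurable.ite (measurableSet_le ((measurable_contValue π hf m (k + 1)).comp h1)
      (by fun_prop)) measurable_const ?_
    refine (Measurable.of_discrete (f := Fin.succ)).comp ((ih (k + 1)).comp (h1.prodMk ?_))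
    exact measurable_pi_iff.2 fun i => (measurable_pi_apply i.succ).comp measurable_snd

lemma isCoordStop_optimalStop (hf : Measurable f) (m k : ℕ) (h : Fin k → 𝒳) :
    IsCoordStop (optimalStop π f m k h) := by
  refine ⟨(measurable_optimalStop π hf m k).comp measurable_prodMk_left, ?_⟩
  induction m generalizing k with
  | zero => intros; rfl
  | succ m ih =>
    intro y y' hy
    have h0 : y 0 = y' 0 := hy 0 (Fin.zero_le _)
    simp only [optimalStop, ← h0] at hy ⊢
    split_ifs with hc
    · rfl
    · rw [if_neg hc] at hy
      congr 1
      exact ih (k + 1) _ _ _ fun j hj => hy j.succ (Fin.succ_le_succ_iff.2 hj)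

lemma integral_optimalStop (hf : Measurable f) (m k : ℕ) (h : Fin k → 𝒳)
    (hG : absRewards π f (m + 1) k h ≠ ⊤) :
    ∫ y, f (y (optimalStop π f m k h y)) ∂tailLaw π (m + 1) k h = contValue π f m k h := by
  have hτ := isCoordStop_optimalStop π hf m k h
  induction m generalizing k with
  | zero =>
    obtain ⟨i1, e1⟩ := integral_tailLaw_succ π 0 k h (measurable_stopped hf hτ.1)
      (integrable_stopped π hf hG hτ.1)
    have e2 : ∀ x y, f (prepend (x, y) (optimalStop π f 0 k h (prepend (x, y)))) = f x :=
      fun x y => rfl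
    simp [e1, e2, contValue]
  | succ m ih =>
    obtain ⟨i1, e1⟩ := integral_tailLaw_succ π (m + 1) k h (measurable_stopped hf hτ.1)
      (integrable_stopped π hf hG hτ.1)
    rw [e1, contValue_eq]
    refine integral_congr_ae ?_
    filter_upwards [ae_absRewards_ne_top π hf hG] with x hx
    rw [snell, extend_last]
    by_cases hc : contValue π f m (k + 1) (extend (h, x)) ≤ f x
    · simp [optimalStop_prepend_of_le π hc, max_eq_left hc]
    · simp only [optimalStop_prepend_of_lt π hc, prepend_succ]
      rw [max_eq_right (not_le.1 hc).le,
        ← ih (k + 1) _ hx (isCoordStop_optimalStop π hf m (k + 1) _)]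

/-- Backward induction computes the conditional utility. -/
theorem condUtility_eq_contValue [TopologicalSpace 𝒳] [TopologicalSpace.MetrizableSpace 𝒳]
    [BorelSpace 𝒳] [SecondCountableTopology 𝒳] [Nonempty 𝒳] (hf : Measurable f) (m k : ℕ)
    (h : Fin k → 𝒳) (hG : absRewards π f (m + 1) k h ≠ ⊤) :
    condUtility π f (m + 1) k h = contValue π f m k h := by
  rw [condUtility, stoppingValue]
  -- The supremum is attained by `optimalStop`, so the default value of `sSup` on unbounded sets
  -- plays no role.
  refine IsGreatest.csSup_eq ⟨?_, ?_⟩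
  · exact ⟨optimalStop π f m k h, (isStoppingTime_iff_isCoordStop _ _).2
      (isCoordStop_optimalStop π hf m k h), (integral_optimalStop π hf m k h hG).symm⟩
  · rintro v ⟨τ, hτ, rfl⟩
    exact integral_stopped_le π hf m k h hG ((isStoppingTime_iff_isCoordStop _ _).1 hτ)

end Utility

/-! ### Optimal stopping of a simulated process -/

section Abstract

variable {Ω : Type*} [MeasurableSpace Ω] {μ : Measure Ω}

/-- The loss of a stopping time with respect to the Snell envelope `W`, where `c` is the value of
continuing. -/
lemma integral_stopped_eq {m : ℕ} {g c W : ℕ → Ω → ℝ} {τ : Ω → ℕ} (hτm : Measurable τ)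
    (hτ : ∀ ω, τ ω ≤ m) (hgτ : Integrable (fun ω => g (τ ω) ω) μ)
    (hg : ∀ i ≤ m, Integrable (g i) μ) (hW : ∀ i ≤ m, Integrable (W i) μ)
    (hc : ∀ i < m, Integrable (c i) μ) (hWm : W m = g m)
    (hstep : ∀ i < m, ∫ ω in {ω | i < τ ω}, W (i + 1) ω ∂μ = ∫ ω in {ω | i < τ ω}, c i ω ∂μ) :
    ∫ ω, g (τ ω) ω ∂μ = ∫ ω, W 0 ω ∂μ - ∑ i ∈ Finset.range m,
      (∫ ω in {ω | τ ω = i}, (W i ω - g i ω) ∂μ + ∫ ω in {ω | i < τ ω}, (W i ω - c i ω) ∂μ) := by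
  -- The losses before time j are split off, leaving the remainder of g(τ) - W_j over {j ≤ τ}. At j
  -- = m the remainder vanishes, because τ = m there and W_m = g_m.
  have key : ∀ j ≤ m, ∫ ω, g (τ ω) ω ∂μ = ∫ ω, W 0 ω ∂μ - ∑ i ∈ Finset.range j,
      (∫ ω in {ω | τ ω = i}, (W i ω - g i ω) ∂μ + ∫ ω in {ω | i < τ ω}, (W i ω - c i ω) ∂μ) +
      (∫ ω in {ω | j ≤ τ ω}, g (τ ω) ω ∂μ - ∫ ω in {ω | j ≤ τ ω}, W j ω ∂μ) := by
    intro j hj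
    induction j with
    | zero => simp
    | succ j ih =>
      have hjm : j < m := hj
      have m1 : MeasurableSet {ω | j < τ ω} := hτm measurableSet_Ioi
      have m2 : MeasurableSet {ω | τ ω = j} := hτm (measurableSet_singleton j)
      have e0 : {ω | j ≤ τ ω} = {ω | τ ω = j} ∪ {ω | j < τ ω} := by
        ext ω; simp only [Set.mem_ofPred_eq, Set.mem_union]; omega
      have hd : Disjoint {ω | τ ω = j} {ω | j < τ ω} := by
        rw [Set.disjoint_left]; intro ω h1 h2; simp only [Set.mem_ofPred_eq] at h1 h2; omega
      have e1 : {ω | j + 1 ≤ τ ω} = {ω | j < τ ω} := rfl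
      have e2 : ∫ ω in {ω | τ ω = j}, g (τ ω) ω ∂μ = ∫ ω in {ω | τ ω = j}, g j ω ∂μ :=
        setIntegral_congr_fun m2 fun ω hω => by
          simp only [Set.mem_ofPred_eq] at hω; simp only [hω]
      rw [ih hjm.le, Finset.sum_range_succ, e0, e1,
        setIntegral_union hd m1 hgτ.integrableOn hgτ.integrableOn,
        setIntegral_union hd m1 (hW j hjm.le).integrableOn (hW j hjm.le).integrableOn, e2,
        integral_sub (hW j hjm.le).integrableOn (hg j hjm.le).integrableOn,
        integral_sub (hW j hjm.le).integrableOn (hc j hjm).integrableOn, hstep j hjm]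
      ring
  rw [key m le_rfl]
  have m3 : MeasurableSet {ω | m ≤ τ ω} := hτm measurableSet_Ici
  have : ∫ ω in {ω | m ≤ τ ω}, g (τ ω) ω ∂μ = ∫ ω in {ω | m ≤ τ ω}, W m ω ∂μ :=
    setIntegral_congr_fun m3 fun ω hω => by
      have : τ ω = m := (hτ ω).antisymm hω
      simp only [this, hWm]
  rw [this]; ring

end Abstract

lemma past_succ {E Ω : Type*} {T : ℕ} (X : Fin T → Ω → E) (k : ℕ) (hk : k < T) (ω : Ω) :
    past X (k + 1) hk ω = extend (past X k hk.le ω, X ⟨k, hk⟩ ω) := by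
  ext i
  cases i using Fin.lastCases with
  | last => simp [past, extend]; rfl
  | cast i => simp [past, extend]

section Simulated

variable {Ω : Type*} [MeasurableSpace Ω] {P : Measure Ω} {T : ℕ} {X : Fin T → Ω → 𝒳}
  {π : (k : ℕ) → Kernel (Fin k → 𝒳) 𝒳}

lemma measurable_past (hX : ∀ i, Measurable (X i)) (k : ℕ) (hk : k ≤ T) :
    Measurable (past X k hk) := measurable_pi_iff.2 fun _ => hX _

lemma map_past_succ (hX : ∀ i, Measurable (X i)) (hπ : Simulates P X π) (k : ℕ) (hk : k < T) :
    P.map (past X (k + 1) hk) = ((P.map (past X k hk.le)) ⊗ₘ π k).map extend := by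
  rw [← (hπ k hk).map_eq, Measure.map_map measurable_extend
    ((measurable_past hX k hk.le).prodMk (hX _))]
  congr 1
  ext1 ω
  exact past_succ X k hk ω

variable [IsProbabilityMeasure P] [∀ k, IsMarkovKernel (π k)]

lemma lintegral_past_succ (hX : ∀ i, Measurable (X i)) (hπ : Simulates P X π) (k : ℕ) (hk : k < T)
    {H : (Fin (k + 1) → 𝒳) → ENNReal} (hH : Measurable H) :
    ∫⁻ ω, H (past X (k + 1) hk ω) ∂P =
      ∫⁻ ω, ∫⁻ x, H (extend (past X k hk.le ω, x)) ∂π k (past X k hk.le ω) ∂P := by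
  rw [← lintegral_map hH (measurable_past hX _ _), map_past_succ hX hπ,
    lintegral_map hH measurable_extend,
    Measure.lintegral_compProd (f := fun q => H (extend q)) (hH.comp measurable_extend)]
  exact lintegral_map ((hH.comp measurable_extend).lintegral_kernel_prod_right')
    (measurable_past hX _ _)

/-- Unbiasedness and integrability of the recursive calls hold only for almost every history; this
passes such statements back to almost every next observation. -/
lemma ae_past_succ (hX : ∀ i, Measurable (X i)) (hπ : Simulates P X π) (k : ℕ) (hk : k < T)
    {Q : (Fin (k + 1) → 𝒳) → Prop} (hQ : ∀ᵐ h ∂P.map (past X (k + 1) hk), Q h) :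
    ∀ᵐ h ∂P.map (past X k hk.le), ∀ᵐ x ∂π k h, Q (extend (h, x)) := by
  rw [map_past_succ hX hπ] at hQ
  have := Measure.isProbabilityMeasure_map (μ := P) (measurable_past hX k hk.le).aemeasurable
  exact Measure.ae_ae_of_ae_compProd (ae_of_ae_map measurable_extend.aemeasurable hQ)

/-- The tower property on events of the past. Set integrals suffice, since it is applied on events
{i < τ}, which are decided by the first i + 1 observations. -/
lemma setIntegral_past_succ (hX : ∀ i, Measurable (X i)) (hπ : Simulates P X π) (k : ℕ)
    (hk : k < T) {H : (Fin (k + 1) → 𝒳) → ℝ} (hH : Measurable H)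
    (hHi : Integrable (fun ω => H (past X (k + 1) hk ω)) P) {B : Set (Fin k → 𝒳)}
    (hB : MeasurableSet B) :
    ∫ ω in past X k hk.le ⁻¹' B, H (past X (k + 1) hk ω) ∂P =
      ∫ ω in past X k hk.le ⁻¹' B, ∫ x, H (extend (past X k hk.le ω, x)) ∂π k (past X k hk.le ω)
        ∂P := by
  have hm := measurable_past hX k hk.le
  have := Measure.isProbabilityMeasure_map (μ := P) hm.aemeasurable
  have hlaw := (hπ k hk).map_eq
  have hpm : Measurable fun ω => (past X k hk.le ω, X ⟨k, hk⟩ ω) := hm.prodMk (hX _)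
  have hHe : Measurable fun q : (Fin k → 𝒳) × 𝒳 => H (extend q) := hH.comp measurable_extend
  simp only [past_succ X k hk] at hHi ⊢
  have hi : Integrable (fun q : (Fin k → 𝒳) × 𝒳 => H (extend q))
      ((P.map (past X k hk.le)) ⊗ₘ π k) := by
    rw [← hlaw, integrable_map_measure hHe.aestronglyMeasurable hpm.aemeasurable]
    exact hHi
  have e1 := Measure.setIntegral_compProd hB MeasurableSet.univ hi.integrableOn
  simp only [Measure.restrict_univ] at e1
  rw [setIntegral_map hB (StronglyMeasurable.aestronglyMeasurable
    hHe.stronglyMeasurable.integral_kernel_prod_right') hm.aemeasurable, ← hlaw,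
    setIntegral_map (hB.prod MeasurableSet.univ) hHe.aestronglyMeasurable hpm.aemeasurable] at e1
  rw [← e1]
  congr 2
  ext ω; simp

variable {f : 𝒳 → ℝ}

lemma measurable_enorm_last_past (hX : ∀ i, Measurable (X i)) (hf : Measurable f) (k : ℕ)
    (hk : k < T) : Measurable fun ω => ‖f (past X (k + 1) hk ω (Fin.last k))‖ₑ :=
  (hf.comp (hX (Fin.castLE hk (Fin.last k)))).enorm

lemma lintegral_absRewards_lt_top (hX : ∀ i, Measurable (X i)) (hπ : Simulates P X π)
    (hf : Measurable f) (hfi : ∀ i, Integrable (fun ω => f (X i ω)) P) (m k : ℕ) (hk : k + m ≤ T) :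
    ∫⁻ ω, absRewards π f m k (past X k (by omega) ω) ∂P < ⊤ := by
  induction m generalizing k with
  | zero => simp [absRewards]
  | succ m ih =>
    have hk' : k < T := by omega
    have h1 := lintegral_past_succ hX hπ k hk'
      (H := fun h => ‖f (h (Fin.last k))‖ₑ + absRewards π f m (k + 1) h)
      ((hf.comp (measurable_pi_apply _)).enorm.add (measurable_absRewards π hf m (k + 1)))
    simp only [extend_last] at h1
    change ∫⁻ ω, ∫⁻ x, ‖f x‖ₑ + absRewards π f m (k + 1) (extend (past X k _ ω, x))
      ∂π k (past X k _ ω) ∂P < ⊤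
    rw [← h1, lintegral_add_left (measurable_enorm_last_past hX hf k hk')]
    refine ENNReal.add_lt_top.2 ⟨?_, ih (k + 1) (by omega)⟩
    exact (hfi ⟨k, hk'⟩).2

lemma ae_absRewards_past_ne_top (hX : ∀ i, Measurable (X i)) (hπ : Simulates P X π)
    (hf : Measurable f) (hfi : ∀ i, Integrable (fun ω => f (X i ω)) P) (m k : ℕ) (hk : k + m ≤ T) :
    ∀ᵐ h ∂P.map (past X k (by omega)), absRewards π f m k h ≠ ⊤ := by
  have h1 := lintegral_absRewards_lt_top hX hπ hf hfi m k hk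
  have hm := measurable_absRewards π hf m k
  rw [← lintegral_map hm (measurable_past hX _ _)] at h1
  filter_upwards [ae_lt_top hm h1.ne] with h hh using hh.ne

lemma integrable_snell_past (hX : ∀ i, Measurable (X i)) (hπ : Simulates P X π)
    (hf : Measurable f) (hfi : ∀ i, Integrable (fun ω => f (X i ω)) P) (m k : ℕ)
    (hk : k + 1 + m ≤ T) :
    Integrable (fun ω => snell π f m k (past X (k + 1) (by omega) ω)) P := by
  refine ⟨((measurable_snell π hf m k).comp (measurable_past hX _ _)).aestronglyMeasurable, ?_⟩
  refine lt_of_le_of_lt (lintegral_mono fun ω => enorm_snell_le π f m k _) ?_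
  rw [lintegral_add_left (measurable_enorm_last_past hX hf k (by omega))]
  exact ENNReal.add_lt_top.2 ⟨(hfi ⟨k, by omega⟩).2,
    lintegral_absRewards_lt_top hX hπ hf hfi m (k + 1) hk⟩

lemma integrable_contValue_past (hX : ∀ i, Measurable (X i)) (hπ : Simulates P X π)
    (hf : Measurable f) (hfi : ∀ i, Integrable (fun ω => f (X i ω)) P) (m k : ℕ)
    (hk : k + (m + 1) ≤ T) :
    Integrable (fun ω => contValue π f m k (past X k (by omega) ω)) P := by
  refine ⟨((measurable_contValue π hf m k).comp (measurable_past hX _ _)).aestronglyMeasurable, ?_⟩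
  exact lt_of_le_of_lt (lintegral_mono fun ω => enorm_contValue_le π f m k _)
    (lintegral_absRewards_lt_top hX hπ hf hfi (m + 1) k hk)

lemma setIntegral_snell_past (hX : ∀ i, Measurable (X i)) (hπ : Simulates P X π)
    (hf : Measurable f) (hfi : ∀ i, Integrable (fun ω => f (X i ω)) P) (m k : ℕ)
    (hk : k + 1 + m ≤ T) {B : Set (Fin k → 𝒳)} (hB : MeasurableSet B) :
    ∫ ω in past X k (by omega) ⁻¹' B, snell π f m k (past X (k + 1) (by omega) ω) ∂P =
      ∫ ω in past X k (by omega) ⁻¹' B, contValue π f m k (past X k (by omega) ω) ∂P := by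
  rw [setIntegral_past_succ hX hπ k (by omega) (measurable_snell π hf m k)
    (integrable_snell_past hX hπ hf hfi m k hk) hB]
  simp only [contValue_eq]

end Simulated

/-! ### The natural filtration in terms of histories -/

section Natural

variable {Ω : Type*} [MeasurableSpace Ω] {T : ℕ} {X : Fin T → Ω → 𝒳}
  [TopologicalSpace 𝒳] [TopologicalSpace.MetrizableSpace 𝒳] [BorelSpace 𝒳]

/-- Times start at 0, so the σ-algebra with index i knows i + 1 observations; hence the history of
length k + 1 is admissible as soon as k ≤ i. -/
lemma measurable_past_natural (hX : ∀ i, StronglyMeasurable (X i)) {k : ℕ} (hk : k < T) {i : Fin T}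
    (hki : k ≤ i) : Measurable[Filtration.natural X hX i] (past X (k + 1) hk) := by
  refine @measurable_pi_iff _ _ _ (_) _ _ |>.2 fun j => ?_
  have h1 : (Fin.castLE hk j : Fin T) ≤ i := by
    rw [Fin.le_def]; simp only [Fin.val_castLE]; omega
  have h2 : MeasurableSpace.comap (X (Fin.castLE hk j)) inferInstance ≤
      Filtration.natural X hX i := le_iSup₂_of_le (f := fun j (_ : j ≤ i) =>
        MeasurableSpace.comap (X j) inferInstance) _ h1 le_rfl
  exact (comap_measurable _).mono h2 le_rfl

lemma exists_preimage_past_of_natural (hX : ∀ i, StronglyMeasurable (X i)) {k : ℕ} (hk : k < T)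
    {A : Set Ω} (hA : MeasurableSet[Filtration.natural X hX ⟨k, hk⟩] A) :
    ∃ B : Set (Fin (k + 1) → 𝒳), MeasurableSet B ∧ A = past X (k + 1) hk ⁻¹' B := by
  rw [Filtration.natural_eq_comap] at hA
  obtain ⟨B, hB, rfl⟩ := hA
  let e : (Fin (k + 1) → 𝒳) → Set.Iic (⟨k, hk⟩ : Fin T) → 𝒳 := fun z j =>
    z ⟨j.1, Nat.lt_succ_of_le (Fin.le_def.1 j.2)⟩
  exact ⟨e ⁻¹' B, (measurable_pi_iff.2 fun j => measurable_pi_apply _) hB, rfl⟩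

end Natural

/-! ### The stopping value of the process itself -/

section StoppingValue

variable {Ω : Type*} [MeasurableSpace Ω] {P : Measure Ω} [IsProbabilityMeasure P] {m : ℕ}
  {X : Fin (m + 1) → Ω → 𝒳} {π : (k : ℕ) → Kernel (Fin k → 𝒳) 𝒳} [∀ k, IsMarkovKernel (π k)]
  [TopologicalSpace 𝒳] [TopologicalSpace.MetrizableSpace 𝒳] [BorelSpace 𝒳] {f : 𝒳 → ℝ}

/-- Backward induction computes the value of the stopping problem. -/
theorem stoppingValue_eq_contValue (hX : ∀ i, StronglyMeasurable (X i)) (hπ : Simulates P X π)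
    (hf : Measurable f) (hfi : ∀ i, Integrable (fun ω => f (X i ω)) P) :
    stoppingValue P X hX f = contValue π f m 0 Fin.elim0 := by
  classical
  have hXm : ∀ i, Measurable (X i) := fun i => (hX i).measurable
  set g : ℕ → Ω → ℝ := fun i ω => if h : i < m + 1 then f (X ⟨i, h⟩ ω) else 0 with hg
  -- After time i there remain m - i observations, and `contValue` with parameter j accounts for j +
  -- 1 of them, hence `m - 1 - i`. All three processes are set to 0 outside their range so that time
  -- can run over ℕ.
  set c : ℕ → Ω → ℝ := fun i ω =>
    if h : i < m then contValue π f (m - 1 - i) (i + 1) (past X (i + 1) (by omega) ω) else 0 with hc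
  set W : ℕ → Ω → ℝ := fun i ω =>
    if h : i ≤ m then snell π f (m - i) i (past X (i + 1) (by omega) ω) else 0 with hW
  have gi : ∀ i ≤ m, Integrable (g i) P := fun i hi => by
    simpa only [hg, Nat.lt_succ_of_le hi, dif_pos] using hfi ⟨i, Nat.lt_succ_of_le hi⟩
  have ci : ∀ i < m, Integrable (c i) P := fun i hi => by
    simp only [hc, hi, dif_pos]
    exact integrable_contValue_past hXm hπ hf hfi _ _ (by omega)
  have Wi : ∀ i ≤ m, Integrable (W i) P := fun i hi => by
    simp only [hW, hi, dif_pos]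
    exact integrable_snell_past hXm hπ hf hfi _ _ (by omega)
  have Wlast : W m = g m := by
    ext ω
    simp only [hW, hg, le_refl, dif_pos, Nat.lt_succ_self, Nat.sub_self, snell]
    rfl
  have Wmax : ∀ i < m, ∀ ω, W i ω = max (g i ω) (c i ω) := fun i hi ω => by
    have h1 : m - i = m - 1 - i + 1 := by omega
    simp only [hW, hg, hc, hi, hi.le, Nat.lt_succ_of_lt hi, dif_pos, h1, snell]
    rfl
  have W0 : ∫ ω, W 0 ω ∂P = contValue π f m 0 Fin.elim0 := by
    have h1 := setIntegral_snell_past hXm hπ hf hfi m 0 (by omega) MeasurableSet.univ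
    simp only [Set.preimage_univ, Measure.restrict_univ] at h1
    simp only [hW, Nat.zero_le, dif_pos, Nat.sub_zero]
    rw [h1]
    have h2 : ∀ ω, past X 0 (Nat.zero_le _) ω = Fin.elim0 := fun ω => Subsingleton.elim _ _
    simp [h2]
  have gm : ∀ i, Measurable (g i) := fun i => by
    by_cases h : i < m + 1
    · simp only [hg, h, dif_pos]; exact hf.comp (hXm ⟨i, h⟩)
    · simp only [hg, h, dif_neg, not_false_eq_true]; exact measurable_const
  -- Every stopping time loses W - g where it stops too early and W - c where it continues too long.
  -- Both losses are nonnegative because W = max(g, c) before time m.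
  have main : ∀ τ : Ω → Fin (m + 1),
      IsStoppingTime (Filtration.natural X hX) (fun ω => (τ ω : WithTop (Fin (m + 1)))) →
      ∫ ω, f (X (τ ω) ω) ∂P = ∫ ω, W 0 ω ∂P - ∑ i ∈ Finset.range m,
        (∫ ω in {ω | (τ ω : ℕ) = i}, (W i ω - g i ω) ∂P +
          ∫ ω in {ω | i < (τ ω : ℕ)}, (W i ω - c i ω) ∂P) := by
    intro τ hτ
    have hτ' : ∀ i, MeasurableSet[Filtration.natural X hX i] {ω | τ ω ≤ i} := fun i => by
      simpa only [WithTop.coe_le_coe] using hτ i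
    have hτm : Measurable τ := measurable_of_Iic fun i => (Filtration.natural X hX).le i _ (hτ' i)
    have hτn : Measurable fun ω => (τ ω : ℕ) := Measurable.of_discrete.comp hτm
    have e : ∀ ω, f (X (τ ω) ω) = g (τ ω) ω := fun ω => by
      simp only [hg, (τ ω).2, dif_pos]
    simp only [e]
    refine integral_stopped_eq hτn (fun ω => Nat.le_of_lt_succ (τ ω).2) ?_ gi Wi ci Wlast ?_
    · have hs : Integrable (fun ω => ∑ i ∈ Finset.range (m + 1), ‖g i ω‖) P :=
        integrable_finsetSum _ fun i hi => (gi i (Nat.le_of_lt_succ (Finset.mem_range.1 hi))).norm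
      refine hs.mono' (Measurable.aestronglyMeasurable ?_) (ae_of_all _ fun ω => ?_)
      · have h1 : Measurable fun q : ℕ × Ω => g q.1 q.2 := measurable_from_prod_countable_right gm
        exact h1.comp (hτn.prodMk measurable_id)
      · exact Finset.single_le_sum (f := fun i => ‖g i ω‖) (fun _ _ => norm_nonneg _)
          (Finset.mem_range.2 (τ ω).2)
    · intro i hi
      have hA : MeasurableSet[Filtration.natural X hX ⟨i, by omega⟩] {ω | i < (τ ω : ℕ)} := by
        have h1 := (hτ' ⟨i, by omega⟩).compl
        convert h1 using 1
        ext ω; simp [Fin.lt_def]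
      obtain ⟨B, hB, eB⟩ := exists_preimage_past_of_natural hX _ hA
      rw [eB]
      have h2 := setIntegral_snell_past hXm hπ hf hfi (m - 1 - i) (i + 1) (by omega) hB
      have h3 : m - (i + 1) = m - 1 - i := by omega
      simpa only [hW, hc, hi, Nat.succ_le_of_lt hi, dif_pos, h3] using h2
  rw [← W0, stoppingValue]
  refine IsGreatest.csSup_eq ⟨?_, ?_⟩
  -- The first time with c ≤ g, or m if there is none, has no loss: W = g when it stops before m,
  -- and W = c at every earlier time.
  · have hex : ∀ ω, ∃ i, m ≤ i ∨ c i ω ≤ g i ω := fun ω => ⟨m, Or.inl le_rfl⟩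
    have hle : ∀ ω, Nat.find (hex ω) ≤ m := fun ω => Nat.find_min' _ (Or.inl le_rfl)
    let τ : Ω → Fin (m + 1) := fun ω => ⟨Nat.find (hex ω), Nat.lt_succ_of_le (hle ω)⟩
    have hst : IsStoppingTime (Filtration.natural X hX)
        (fun ω => (τ ω : WithTop (Fin (m + 1)))) := by
      intro i
      simp only [WithTop.coe_le_coe]
      have e : {ω | τ ω ≤ i} = ⋃ j ∈ Finset.range (i + 1), {ω | m ≤ j ∨ c j ω ≤ g j ω} := by
        ext ω
        simp only [τ, Fin.le_def, Set.mem_ofPred_eq, Nat.find_le_iff, Set.mem_iUnion,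
          Finset.mem_range, Nat.lt_succ_iff, exists_prop]
      rw [e]
      refine Finset.measurableSet_biUnion _ fun j hj => ?_
      by_cases hjm : m ≤ j
      · simp only [hjm, true_or]; exact @MeasurableSet.univ _ (_)
      · have hj' : j < m := not_le.1 hjm
        have hji : j ≤ i := Nat.lt_succ_iff.1 (Finset.mem_range.1 hj)
        have hp := measurable_past_natural hX (k := j) (by omega) hji
        simp only [hjm, false_or, hc, hg, hj', dif_pos, Nat.lt_succ_of_lt hj']
        exact hp (measurableSet_le (measurable_contValue π hf (m - 1 - j) (j + 1))
          (hf.comp (measurable_pi_apply (Fin.last j))))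
    refine ⟨τ, hst, ?_⟩
    rw [main τ hst, Finset.sum_eq_zero, sub_zero]
    intro i hi
    have him : i < m := Finset.mem_range.1 hi
    rw [setIntegral_eq_zero_of_forall_eq_zero, setIntegral_eq_zero_of_forall_eq_zero, add_zero]
    · intro ω hω
      have h1 := Nat.find_min (hex ω) (m := i) hω
      push Not at h1
      rw [Wmax i him, max_eq_right h1.2.le, sub_self]
    · intro ω hω
      have h1 := Nat.find_spec (hex ω)
      rw [show Nat.find (hex ω) = i from hω] at h1
      rw [Wmax i him, max_eq_left (h1.resolve_left (by omega)), sub_self]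
  · rintro v ⟨τ, hτ, rfl⟩
    rw [main τ hτ]
    refine sub_le_self _ (Finset.sum_nonneg fun i hi => add_nonneg ?_ ?_) <;>
    refine integral_nonneg fun ω => ?_ <;>
    simp [Wmax i (Finset.mem_range.1 hi)]

end StoppingValue

/-! ### One recursion step: the mean -/

section Mean

variable (π : (k : ℕ) → Kernel (Fin k → 𝒳) 𝒳) [∀ k, IsMarkovKernel (π k)] {f : 𝒳 → ℝ}

lemma extendLaw_apply (k : ℕ) (h : Fin k → 𝒳) :
    (Kernel.id ×ₖ π k).map extend h = (π k h).map fun x => extend (h, x) := by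
  rw [Kernel.map_apply _ measurable_extend, Kernel.prod_apply, Kernel.id_apply,
    Measure.dirac_prod, Measure.map_map measurable_extend measurable_prodMk_left]
  rfl

lemma integral_fst_branch (hf : Measurable f) (r : unitInterval) {k : ℕ}
    (K : Kernel (Fin (k + 1) → 𝒳) (ℝ × ℕ)) [IsMarkovKernel K] (h : Fin (k + 1) → 𝒳) (n : ℕ) :
    ∫ z, z.1 ∂branch f r K (h, n) =
      (∫ y : Fin (2 ^ n) → ℝ × ℕ, delta n (f (h (Fin.last k))) (fun i => (y i).1)
        ∂Measure.pi fun _ => K h) / geoPMF r n := by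
  have hc := measurable_combine_last hf r n k
  rw [branch_apply, Kernel.map_apply _ hc,
    integral_map hc.aemeasurable measurable_fst.aestronglyMeasurable, Kernel.prod_apply,
    Kernel.id_apply, Measure.dirac_prod, iid_apply, ← integral_div]
  exact integral_map measurable_prodMk_left.aemeasurable
    (measurable_fst.comp hc).aestronglyMeasurable

/-- If the output of a call is integrable and the recursive calls are unbiased, then so is the
call. -/
lemma integral_fst_muse_succ (hf : Measurable f) (r : ℕ → unitInterval) (m k : ℕ)
    (hr0 : r (k + 1) ≠ 0) (hr1 : r (k + 1) ≠ 1) {p : ℝ} (hp : 2 < p) (hp3 : p ≤ 3) {h : Fin k → 𝒳}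
    (hi : Integrable (fun z : ℝ × ℕ => z.1) (muse π f r (m + 1) k h))
    (hrec : ∀ᵐ x ∂π k h,
      Integrable (fun z : ℝ × ℕ => |z.1| ^ p) (muse π f r m (k + 1) (extend (h, x))) ∧
      ∫ z, z.1 ∂muse π f r m (k + 1) (extend (h, x)) = contValue π f m (k + 1) (extend (h, x))) :
    ∫ z, z.1 ∂muse π f r (m + 1) k h = contValue π f (m + 1) k h := by
  have := isMarkovKernel_muse π hf r m (k + 1)
  have := isMarkovKernel_branch hf (r (k + 1)) (muse π f r m (k + 1))
  have := Kernel.IsMarkovKernel.map (Kernel.id ×ₖ π k) (measurable_extend (𝒳 := 𝒳) (k := k))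
  have hem : Measurable fun x => extend (h, x) := measurable_extend.comp measurable_prodMk_left
  rw [muse] at hi ⊢
  have h1 := hi.integral_comp
  rw [Kernel.integral_comp hi]
  rw [Kernel.prod_apply, Kernel.const_apply] at h1 ⊢
  rw [integral_prod _ h1, extendLaw_apply, integral_map hem.aemeasurable (by
    have := h1.integral_prod_left.aestronglyMeasurable
    rwa [extendLaw_apply] at this)]
  have h2 := h1.prod_right_ae
  rw [extendLaw_apply] at h2
  have h3 := ae_of_ae_map hem.aemeasurable h2
  rw [contValue_eq]
  refine integral_congr_ae ?_
  filter_upwards [h3, hrec] with x hx ⟨hx1, hx2⟩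
  have hpos : ∀ n, geoPMF (r (k + 1)) n ≠ 0 := fun n => by
    rw [geoPMF, mul_comm]; exact (geometricMeasure_pos hr0 hr1 n).ne'
  -- The probability of the level cancels the division by `geoPMF` in the output.
  have e : ∀ n, ((1 - (r (k + 1) : ℝ)) ^ n * r (k + 1)) *
      ∫ z, z.1 ∂branch f (r (k + 1)) (muse π f r m (k + 1)) (extend (h, x), n) =
      ∫ y : Fin (2 ^ n) → ℝ × ℕ, delta n (f x) (fun i => (y i).1)
        ∂Measure.pi fun _ => muse π f r m (k + 1) (extend (h, x)) := fun n => by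
    rw [integral_fst_branch hf, extend_last, mul_comm _ (r (k + 1) : ℝ)]
    exact mul_div_cancel₀ _ (hpos n)
  -- Integrability of the output over the random level is what makes the mean differences summable;
  -- telescoping then identifies their sum.
  have hs := hasSum_integral_geometricMeasure hr0 hx
  simp only [smul_eq_mul, e] at hs
  rw [snell, extend_last, ← hx2]
  exact hs.unique (hasSum_integral_delta measurable_fst hp hp3 hx1 (f x) hs.summable)

end Mean

/-! ### One recursion step: moments -/

/-- For ε = 2^(-n/4) the level s balances the first and the third quantity: both have exponent
-n(q/2 + (p - q)/(4p)), where (p - q)/(4p) = 9d/(80 + 40d) and q/2 = 1 + d/20 ≥ 1. The second has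
exponent -n(1 + 11d/40), which is smaller than required. -/
lemma rpow_exponent_bounds {d : ℝ} (hd : 0 < d) (n : ℕ) :
    let p := 2 + d
    let q := 2 + d / 10
    let s := (2 : ℝ) ^ (-((n : ℝ) * (1 / 2 - 1 / (4 * p))))
    let ε := (2 : ℝ) ^ (-((n : ℝ) * (1 / 4)))
    let t := (2 : ℝ) ^ (-((n : ℝ) * (1 + 9 * d / (80 + 40 * d))))
    s ^ (q - p) * (2 : ℝ) ^ (-(n * (p / 2))) ≤ t ∧
      ε ^ (q - p) * (2 : ℝ) ^ (-(n * (p / 2))) ≤ t ∧ s ^ q * ε ≤ t := by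
  intro p q s ε t
  have h2 : (0 : ℝ) < 2 := two_pos
  have hn : (0 : ℝ) ≤ n := n.cast_nonneg
  have hp : p ≠ 0 := by simp only [p]; positivity
  have hb : 9 * d / (80 + 40 * d) ≤ 9 * d / 80 := by
    apply div_le_div_of_nonneg_left <;> linarith
  have e1 : 9 * d / (80 + 40 * d) = (p - q) * (1 / (4 * p)) := by
    simp only [p, q]
    have : 2 + d ≠ 0 := by positivity
    have : 80 + 40 * d ≠ 0 := by positivity
    field_simp
    ring
  refine ⟨?_, ?_, ?_⟩ <;>
    simp only [s, ε, t, ← Real.rpow_mul h2.le, ← Real.rpow_add h2] <;>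
    refine Real.rpow_le_rpow_of_exponent_le one_le_two ?_
  · rw [e1]
    have : -(n * (1 / 2 - 1 / (4 * p))) * (q - p) + -(n * (p / 2)) =
      -(n * (q / 2 + (p - q) * (1 / (4 * p)))) := by ring
    rw [this]
    have : q / 2 = 1 + d / 20 := by simp only [q]; ring
    rw [this]
    gcongr
    linarith
  · have : -(n * (1 / 4)) * (q - p) + -(n * (p / 2)) = -(n * (1 + 11 * d / 40)) := by
      simp only [p, q]; ring
    rw [this]
    refine neg_le_neg (mul_le_mul_of_nonneg_left ?_ hn)
    linarith
  · have : -(n * (1 / 2 - 1 / (4 * p))) * q + -(n * (1 / 4)) =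
        -(n * (q / 2 + (p - q) * (1 / (4 * p)))) := by
      field_simp; ring
    rw [this, e1]
    have : q / 2 = 1 + d / 20 := by simp only [q]; ring
    rw [this]
    gcongr
    linarith

/-- The exponent of the geometric distribution, as a function of the gain `d` of integrability. -/
def rateOf (d : ℝ) : ℝ := (2 + 9 * d / (80 + 40 * d)) / (2 + d / 10)

/-- The inequality amounts to 80 + 40d < 90, that is d < 1/4, the origin of the restriction on η. It
is used twice: for the moments of a call and for its expected cost. -/
lemma one_lt_rateOf {d : ℝ} (hd : 0 < d) (hd4 : d < 1 / 4) : 1 < rateOf d := by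
  rw [rateOf, one_lt_div (by positivity)]
  have : d / 10 < 9 * d / (80 + 40 * d) := by
    rw [div_lt_div_iff₀ (by norm_num) (by positivity)]
    nlinarith
  linarith

section Moments

variable {Ω : Type*} [MeasurableSpace Ω] {P : Measure Ω} [IsProbabilityMeasure P] {T : ℕ}
  {X : Fin T → Ω → 𝒳} {π : (k : ℕ) → Kernel (Fin k → 𝒳) 𝒳} [∀ k, IsMarkovKernel (π k)]
  {f : 𝒳 → ℝ}

lemma measurable_ofReal_delta_rpow (n : ℕ) (q : ℝ) :
    Measurable (Function.uncurry fun (a : ℝ) (y : Fin (2 ^ n) → ℝ × ℕ) =>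
      ENNReal.ofReal (|delta n a fun i => (y i).1| ^ q)) := by
  have h1 : Measurable fun w : ℝ × (Fin (2 ^ n) → ℝ × ℕ) => delta n w.1 fun i => (w.2 i).1 :=
    (measurable_delta n).comp (f := fun w : ℝ × (Fin (2 ^ n) → ℝ × ℕ) =>
      (w.1, fun i => (w.2 i).1)) (by fun_prop)
  exact (h1.abs.pow_const q).ennreal_ofReal

/-- The `q`-th absolute moment of a call, split according to the level. -/
lemma lintegral_muse_succ_rpow (hX : ∀ i, Measurable (X i)) (hπ : Simulates P X π)
    (hf : Measurable f) (r : ℕ → unitInterval) (m k : ℕ) (hk : k < T) (hr0 : r (k + 1) ≠ 0)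
    (hr1 : r (k + 1) ≠ 1) (q : ℝ) :
    ∫⁻ ω, ∫⁻ z, ENNReal.ofReal (|z.1| ^ q) ∂muse π f r (m + 1) k (past X k hk.le ω) ∂P =
      ∑' n, ENNReal.ofReal (geoPMF (r (k + 1)) n ^ (1 - q)) *
        ∫⁻ ω, ∫⁻ y : Fin (2 ^ n) → ℝ × ℕ,
          ENNReal.ofReal (|delta n (f (past X (k + 1) hk ω (Fin.last k))) fun i => (y i).1| ^ q)
          ∂(Measure.pi fun _ => muse π f r m (k + 1) (past X (k + 1) hk ω)) ∂P := by
  have hm := fun n => measurable_lintegral_pi_muse π hf r m k (2 ^ n)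
    (measurable_ofReal_delta_rpow n q)
  have hmω : ∀ n, Measurable fun ω => ∫⁻ y : Fin (2 ^ n) → ℝ × ℕ,
      ENNReal.ofReal (|delta n (f (past X (k + 1) hk ω (Fin.last k))) fun i => (y i).1| ^ q)
      ∂(Measure.pi fun _ => muse π f r m (k + 1) (past X (k + 1) hk ω)) :=
    fun n => (hm n).comp (measurable_past hX (k + 1) hk)
  have hpos : ∀ n, 0 < geoPMF (r (k + 1)) n := fun n => by
    rw [geoPMF, mul_comm]; exact geometricMeasure_pos hr0 hr1 n
  have hstep : ∀ h : Fin k → 𝒳, ∫⁻ z, ENNReal.ofReal (|z.1| ^ q) ∂muse π f r (m + 1) k h =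
      ∫⁻ x, ∑' n, ENNReal.ofReal (geoPMF (r (k + 1)) n ^ (1 - q)) *
        ∫⁻ y : Fin (2 ^ n) → ℝ × ℕ,
          ENNReal.ofReal (|delta n (f (extend (h, x) (Fin.last k))) fun i => (y i).1| ^ q)
          ∂(Measure.pi fun _ => muse π f r m (k + 1) (extend (h, x))) ∂π k h := by
    intro h
    rw [lintegral_muse_succ π hf r m k hr0 h (F := fun z => ENNReal.ofReal (|z.1| ^ q))
      (by fun_prop)]
    refine lintegral_congr fun x => tsum_congr fun n => ?_
    -- The division by `geoPMF` contributes the power -q; the probability of the level itself adds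
    -- 1, giving the weight 1 - q.
    have e : ∀ y : Fin (2 ^ n) → ℝ × ℕ,
        ENNReal.ofReal (|(combine (r (k + 1)) n (f x) y).1| ^ q) =
        ENNReal.ofReal (geoPMF (r (k + 1)) n ^ (-q)) *
          ENNReal.ofReal (|delta n (f x) fun i => (y i).1| ^ q) := fun y => by
      rw [← ENNReal.ofReal_mul (Real.rpow_nonneg (hpos n).le _), combine, abs_div,
        Real.div_rpow (abs_nonneg _) (abs_nonneg _), abs_of_pos (hpos n),
        Real.rpow_neg (hpos n).le, div_eq_inv_mul]
    have hmy : Measurable fun y : Fin (2 ^ n) → ℝ × ℕ =>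
        ENNReal.ofReal (|delta n (f x) fun i => (y i).1| ^ q) :=
      (measurable_ofReal_delta_rpow n q).comp measurable_prodMk_left
    simp only [e, extend_last]
    rw [lintegral_const_mul _ hmy,
      ← mul_assoc, ← ENNReal.ofReal_mul (hpos n).le, sub_eq_add_neg, Real.rpow_add (hpos n),
      Real.rpow_one]
  simp only [hstep]
  rw [← lintegral_past_succ hX hπ k hk (H := fun h =>
    ∑' n, ENNReal.ofReal (geoPMF (r (k + 1)) n ^ (1 - q)) * ∫⁻ y : Fin (2 ^ n) → ℝ × ℕ,
      ENNReal.ofReal (|delta n (f (h (Fin.last k))) fun i => (y i).1| ^ q)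
      ∂(Measure.pi fun _ => muse π f r m (k + 1) h))
      (Measurable.tsum fun n => (hm n).const_mul _),
    lintegral_tsum fun n => ((hmω n).const_mul _).aemeasurable]
  exact tsum_congr fun n => lintegral_const_mul _ (hmω n)

lemma ofReal_abs_max_rpow_le {p q : ℝ} (hq : 0 ≤ q) (hqp : q ≤ p) (a y : ℝ) :
    ENNReal.ofReal (|max a y| ^ q) ≤
      1 + (ENNReal.ofReal (|a| ^ p) + ENNReal.ofReal (|y| ^ p)) := by
  rw [← ENNReal.ofReal_one, ← ENNReal.ofReal_add (by positivity) (by positivity),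
    ← ENNReal.ofReal_add (by positivity) (by positivity)]
  refine ENNReal.ofReal_le_ofReal ?_
  have key : ∀ x : ℝ, |x| ^ q ≤ 1 + |x| ^ p := fun x => by
    rcases le_total |x| 1 with h1 | h1
    · have := Real.rpow_le_one (abs_nonneg _) h1 hq
      have := Real.rpow_nonneg (abs_nonneg x) p
      linarith
    · have := Real.rpow_le_rpow_of_exponent_le h1 hqp
      linarith
  have h1 := Real.rpow_nonneg (abs_nonneg a) p
  have h2 := Real.rpow_nonneg (abs_nonneg y) p
  rcases max_choice a y with e | e <;> rw [e]
  · linarith [key a]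
  · linarith [key y]

/-- The recursion step for the moments. -/
theorem lintegral_muse_succ_rpow_lt_top (hX : ∀ i, Measurable (X i)) (hπ : Simulates P X π)
    (hf : Measurable f) (r : ℕ → unitInterval) (m k : ℕ) (hk : k < T) {d : ℝ} (hd : 0 < d)
    (hd4 : d < 1 / 4) (hr : (r (k + 1) : ℝ) = 1 - 2 ^ (-rateOf d))
    (hrec : ∫⁻ ω, ∫⁻ z, ENNReal.ofReal (|z.1| ^ (2 + d))
      ∂muse π f r m (k + 1) (past X (k + 1) hk ω) ∂P < ⊤)
    (hfp : ∫⁻ ω, ENNReal.ofReal (|f (X ⟨k, hk⟩ ω)| ^ (2 + d)) ∂P < ⊤)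
    (hmean : ∀ᵐ ω ∂P, ∫ z, z.1 ∂muse π f r m (k + 1) (past X (k + 1) hk ω) =
      contValue π f m (k + 1) (past X (k + 1) hk ω)) {C : ℝ} (hC0 : 0 ≤ C)
    (hC : ∀ ε : ℝ, 0 < ε → P {ω | |contValue π f m (k + 1) (past X (k + 1) hk ω)
      - f (X ⟨k, hk⟩ ω)| < ε} ≤ ENNReal.ofReal (C * ε)) :
    ∫⁻ ω, ∫⁻ z, ENNReal.ofReal (|z.1| ^ (2 + d / 10))
      ∂muse π f r (m + 1) k (past X k hk.le ω) ∂P < ⊤ := by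
  have hrate := one_lt_rateOf hd hd4
  have hw0 : (0 : ℝ) < 2 ^ (-rateOf d) := by positivity
  have hw1 : (2 : ℝ) ^ (-rateOf d) < 1 :=
    Real.rpow_lt_one_of_one_lt_of_neg one_lt_two (by linarith)
  have hr0 : r (k + 1) ≠ 0 := fun h => by
    rw [h] at hr; simp only [Set.Icc.coe_zero] at hr; linarith
  have hr1 : r (k + 1) ≠ 1 := fun h => by
    rw [h] at hr; simp only [Set.Icc.coe_one] at hr; linarith
  have hrpos : (0 : ℝ) < r (k + 1) := by rw [hr]; linarith
  have hgeo : ∀ n, geoPMF (r (k + 1)) n = r (k + 1) * (2 : ℝ) ^ (-(n * rateOf d)) := fun n => by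
    rw [geoPMF, hr, sub_sub_cancel, ← Real.rpow_natCast, ← Real.rpow_mul two_pos.le]
    congr 2; ring
  have := fun h => (isMarkovKernel_muse π hf r m (k + 1)).isProbabilityMeasure h
  rw [lintegral_muse_succ_rpow hX hπ hf r m k hk hr0 hr1]
  set q : ℝ := 2 + d / 10 with hq
  set p : ℝ := 2 + d with hp
  set B := ∫⁻ ω, ∫⁻ z, ENNReal.ofReal (|z.1| ^ p)
      ∂muse π f r m (k + 1) (past X (k + 1) hk ω) ∂P with hB
  have hmB : Measurable fun ω => ∫⁻ z, ENNReal.ofReal (|z.1| ^ p)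
      ∂muse π f r m (k + 1) (past X (k + 1) hk ω) :=
    (Measurable.lintegral_kernel (κ := muse π f r m (k + 1))
      (f := fun z : ℝ × ℕ => ENNReal.ofReal (|z.1| ^ p)) (by fun_prop)).comp
      (measurable_past hX (k + 1) hk)
  set D : ℕ → ENNReal := fun n => ∫⁻ ω, ∫⁻ y : Fin (2 ^ n) → ℝ × ℕ,
    ENNReal.ofReal (|delta n (f (past X (k + 1) hk ω (Fin.last k))) fun i => (y i).1| ^ q)
      ∂(Measure.pi fun _ => muse π f r m (k + 1) (past X (k + 1) hk ω)) ∂P with hD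
  -- Level 0 is a maximum and not a difference, so it is bounded directly by the moments of the
  -- reward and of one recursive call.
  have hD0 : D 0 < ⊤ := by
    have h1 : D 0 ≤ ∫⁻ ω, 1 + (ENNReal.ofReal (|f (X ⟨k, hk⟩ ω)| ^ p) +
        ∫⁻ z, ENNReal.ofReal (|z.1| ^ p) ∂muse π f r m (k + 1) (past X (k + 1) hk ω)) ∂P := by
      refine lintegral_mono fun ω => ?_
      refine (lintegral_mono fun y => ofReal_abs_max_rpow_le (p := p)
        (by positivity) (by rw [hp, hq]; linarith) _ _).trans ?_
      rw [lintegral_add_left measurable_const, lintegral_add_left measurable_const,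
        lintegral_const, lintegral_const, measure_univ, mul_one, mul_one]
      refine add_le_add le_rfl (add_le_add le_rfl (le_of_eq ?_))
      exact (measurePreserving_eval
        (fun _ : Fin (2 ^ 0) => muse π f r m (k + 1) (past X (k + 1) hk ω)) 0).lintegral_comp
        (f := fun z => ENNReal.ofReal (|z.1| ^ p)) (by fun_prop)
    refine h1.trans_lt ?_
    rw [lintegral_add_left measurable_const, lintegral_add_right _ hmB]
    simp only [lintegral_const, measure_univ, mul_one]
    exact ENNReal.add_lt_top.2 ⟨ENNReal.one_lt_top, ENNReal.add_lt_top.2 ⟨hfp, hrec⟩⟩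
  -- The terms with s^(q-p) and ε^(q-p) are each at most t after multiplication by 2^(-np/2), so 384
  -- doubles to 768; the small-ball event contributes C ε s^q ≤ C t.
  have hDn : ∀ n : ℕ, D (n + 1) ≤ ENNReal.ofReal ((768 * B.toReal + C) *
      (2 : ℝ) ^ (-((n : ℝ) * (1 + 9 * d / (80 + 40 * d))))) := by
    intro n
    obtain ⟨b1, b2, b3⟩ := rpow_exponent_bounds hd n
    simp only [← hp, ← hq] at b1 b2 b3
    set s := (2 : ℝ) ^ (-((n : ℝ) * (1 / 2 - 1 / (4 * p))))
    set ε := (2 : ℝ) ^ (-((n : ℝ) * (1 / 4)))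
    set t := (2 : ℝ) ^ (-((n : ℝ) * (1 + 9 * d / (80 + 40 * d))))
    have hs : 0 < s := by positivity
    have hε : 0 < ε := by positivity
    have hmS : MeasurableSet {ω | |contValue π f m (k + 1) (past X (k + 1) hk ω)
        - f (X ⟨k, hk⟩ ω)| < ε} := by
      have h1 : Measurable fun ω => |contValue π f m (k + 1) (past X (k + 1) hk ω)
          - f (X ⟨k, hk⟩ ω)| := (((measurable_contValue π hf m (k + 1)).comp
            (measurable_past hX (k + 1) hk)).sub (hf.comp (hX ⟨k, hk⟩))).abs
      exact h1 measurableSet_Iio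
    set S := {ω | |contValue π f m (k + 1) (past X (k + 1) hk ω) - f (X ⟨k, hk⟩ ω)| < ε} with hS
    have h1 : D (n + 1) ≤ ∫⁻ ω, ENNReal.ofReal ((s ^ (q - p) + ε ^ (q - p)) *
        (384 * (2 : ℝ) ^ (-(n * (p / 2))))) *
        (∫⁻ z, ENNReal.ofReal (|z.1| ^ p) ∂muse π f r m (k + 1) (past X (k + 1) hk ω)) +
        S.indicator (fun _ => ENNReal.ofReal (s ^ q)) ω ∂P := by
      refine lintegral_mono_ae ?_
      filter_upwards [hmean] with ω hω
      have h2 := lintegral_abs_delta_rpow_le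
        (κ := muse π f r m (k + 1) (past X (k + 1) hk ω)) (g := Prod.fst) measurable_fst
        (p := p) (by rw [hp]; linarith) (by rw [hp]; linarith) (q := q) (by positivity)
        (by rw [hp, hq]; linarith) hs hε n (f (X ⟨k, hk⟩ ω))
      rw [hω] at h2
      exact h2
    refine h1.trans ?_
    rw [lintegral_add_left (hmB.const_mul _), lintegral_const_mul _ hmB, ← hB,
      lintegral_indicator_const hmS, ← ENNReal.ofReal_toReal hrec.ne]
    refine (add_le_add le_rfl (mul_le_mul_right (hC ε hε) _)).trans ?_
    rw [← ENNReal.ofReal_mul (by positivity), ← ENNReal.ofReal_mul (by positivity),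
      ← ENNReal.ofReal_add (by positivity) (by positivity)]
    refine ENNReal.ofReal_le_ofReal ?_
    rw [ENNReal.toReal_ofReal ENNReal.toReal_nonneg]
    have hB0 : 0 ≤ B.toReal := ENNReal.toReal_nonneg
    have c1 := mul_le_mul_of_nonneg_left (add_le_add b1 b2) (by positivity : 0 ≤ 384 * B.toReal)
    have c2 := mul_le_mul_of_nonneg_left b3 hC0
    nlinarith
  rw [tsum_eq_zero_add' ENNReal.summable]
  refine ENNReal.add_lt_top.2 ⟨ENNReal.mul_lt_top ENNReal.ofReal_lt_top hD0, ?_⟩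
  have hθ : (2 : ℝ) ^ (1 - rateOf d) < 1 :=
    Real.rpow_lt_one_of_one_lt_of_neg one_lt_two (by linarith)
  have hsum : Summable fun n : ℕ => (r (k + 1) : ℝ) ^ (1 - q) * (2 : ℝ) ^ (rateOf d * (q - 1)) *
      (768 * B.toReal + C) * ((2 : ℝ) ^ (1 - rateOf d)) ^ n :=
    (summable_geometric_of_lt_one (by positivity) hθ).mul_left _
  refine lt_of_le_of_lt (ENNReal.tsum_le_tsum fun n => ?_) hsum.tsum_ofReal_lt_top
  refine (mul_le_mul_right (hDn n) _).trans ?_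
  rw [← ENNReal.ofReal_mul (Real.rpow_nonneg (by rw [hgeo]; positivity) _)]
  refine ENNReal.ofReal_le_ofReal (le_of_eq ?_)
  -- By the definition of `rateOf`, t has exponent -n(ρq - 2 + 1) with ρ the rate; against the
  -- weight's exponent (n + 1)ρ(q - 1) this leaves n(1 - ρ) plus a constant.
  have e1 : geoPMF (r (k + 1)) (n + 1) ^ (1 - q) *
      (2 : ℝ) ^ (-((n : ℝ) * (1 + 9 * d / (80 + 40 * d)))) =
      (r (k + 1) : ℝ) ^ (1 - q) * (2 : ℝ) ^ (rateOf d * (q - 1)) *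
        ((2 : ℝ) ^ (1 - rateOf d)) ^ n := by
    rw [hgeo, Real.mul_rpow hrpos.le (by positivity), ← Real.rpow_mul two_pos.le,
      ← Real.rpow_natCast ((2 : ℝ) ^ (1 - rateOf d)), ← Real.rpow_mul two_pos.le, mul_assoc,
      mul_assoc, ← Real.rpow_add two_pos, ← Real.rpow_add two_pos]
    congr 2
    have e2 : 9 * d / (80 + 40 * d) = rateOf d * q - 2 := by
      rw [rateOf, hq, div_mul_cancel₀ _ (by positivity)]; ring
    rw [e2]; push_cast; ring
  calc _ = (768 * B.toReal + C) * (geoPMF (r (k + 1)) (n + 1) ^ (1 - q) *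
      (2 : ℝ) ^ (-((n : ℝ) * (1 + 9 * d / (80 + 40 * d))))) := by ring
    _ = _ := by rw [e1]; ring

end Moments

/-! ### The parameters -/

/-- The gain of integrability over square integrability of a call with a history of length `k`. -/
def gain (T : ℕ) (η : ℝ) (k : ℕ) : ℝ := η * (10 : ℝ) ^ ((k : ℤ) + 1 - T)

lemma gain_pos {T : ℕ} {η : ℝ} (hη : 0 < η) (k : ℕ) : 0 < gain T η k := by
  unfold gain; positivity

lemma gain_succ (T : ℕ) (η : ℝ) (k : ℕ) : gain T η k = gain T η (k + 1) / 10 := by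
  unfold gain
  push_cast
  rw [show (k : ℤ) + 1 + 1 - T = ((k : ℤ) + 1 - T) + 1 by ring, zpow_add_one₀ (by norm_num)]
  ring

lemma gain_le {T : ℕ} {η : ℝ} (hη : 0 < η) {k : ℕ} (hk : k < T) : gain T η k ≤ η := by
  unfold gain
  refine mul_le_of_le_one_right hη.le (zpow_le_one_of_nonpos₀ (by norm_num) ?_)
  have : (k : ℤ) + 1 ≤ T := by exact_mod_cast hk
  linarith

lemma rate_eq_rateOf (T : ℕ) (η : ℝ) (k : ℕ) : rate T η (k + 1) = rateOf (gain T η (k + 1)) := by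
  have h := gain_succ T η k
  rw [rate, rateOf, ← h]
  unfold gain
  push_cast
  rfl

lemma museParam_coe {T : ℕ} {η : ℝ} (hη : 0 < η) (k : ℕ) :
    (museParam T η hη (k + 1) : ℝ) = 1 - 2 ^ (-rateOf (gain T η (k + 1))) := by
  rw [← rate_eq_rateOf]; rfl

lemma one_lt_rateOf_gain {T : ℕ} {η : ℝ} (hη : 0 < η) (hη4 : η < 1 / 4) {k : ℕ}
    (hk : k + 1 < T) : 1 < rateOf (gain T η (k + 1)) :=
  one_lt_rateOf (gain_pos hη _) ((gain_le hη hk).trans_lt hη4)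

lemma museParam_ne_zero {T : ℕ} {η : ℝ} (hη : 0 < η) (hη4 : η < 1 / 4) {k : ℕ}
    (hk : k + 1 < T) :
    museParam T η hη (k + 1) ≠ 0 := fun h => by
  have h1 := museParam_coe (T := T) hη k
  have h2 : (2 : ℝ) ^ (-rateOf (gain T η (k + 1))) < 1 :=
    Real.rpow_lt_one_of_one_lt_of_neg one_lt_two (by linarith [one_lt_rateOf_gain hη hη4 hk])
  rw [h] at h1; simp only [Set.Icc.coe_zero] at h1; linarith

lemma museParam_ne_one {T : ℕ} {η : ℝ} (hη : 0 < η) (k : ℕ) : museParam T η hη (k + 1) ≠ 1 :=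
  fun h => by
    have h1 := museParam_coe (T := T) hη k
    have h2 : (0 : ℝ) < 2 ^ (-rateOf (gain T η (k + 1))) := by positivity
    rw [h] at h1; simp only [Set.Icc.coe_one] at h1; linarith

/-! ### Moments and mean of the estimator -/

lemma integrable_abs_rpow_of_lintegral {α : Type*} [MeasurableSpace α] {κ : Measure α} {g : α → ℝ}
    (hg : Measurable g) {p : ℝ} (h : ∫⁻ z, ENNReal.ofReal (|g z| ^ p) ∂κ < ⊤) :
    Integrable (fun z => |g z| ^ p) κ := by
  refine ⟨Measurable.aestronglyMeasurable (by fun_prop), ?_⟩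
  rwa [hasFiniteIntegral_iff_ofReal (ae_of_all _ fun z => by positivity)]

section Recursion

variable {Ω : Type*} [MeasurableSpace Ω] {P : Measure Ω} {T : ℕ}
  {X : Fin T → Ω → 𝒳} {π : (k : ℕ) → Kernel (Fin k → 𝒳) 𝒳} {f : 𝒳 → ℝ}

lemma ae_integrable_muse_rpow (hX : ∀ i, Measurable (X i)) {r : ℕ → unitInterval} {m k : ℕ}
    (hk : k ≤ T) {p : ℝ}
    (h : ∫⁻ ω, ∫⁻ z, ENNReal.ofReal (|z.1| ^ p) ∂muse π f r m k (past X k hk ω) ∂P < ⊤) :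
    ∀ᵐ h ∂P.map (past X k hk), Integrable (fun z : ℝ × ℕ => |z.1| ^ p) (muse π f r m k h) := by
  have hm : Measurable fun h => ∫⁻ z, ENNReal.ofReal (|z.1| ^ p) ∂muse π f r m k h :=
    Measurable.lintegral_kernel (f := fun z : ℝ × ℕ => ENNReal.ofReal (|z.1| ^ p)) (by fun_prop)
  rw [← lintegral_map hm (measurable_past hX k hk)] at h
  filter_upwards [ae_lt_top hm h.ne] with h hh using
    integrable_abs_rpow_of_lintegral measurable_fst hh

variable [IsProbabilityMeasure P] [∀ k, IsMarkovKernel (π k)]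

/-- Along the simulated process, the estimator has more than two moments and is unbiased. -/
theorem muse_moment_and_mean (hX : ∀ i, Measurable (X i)) (hπ : Simulates P X π)
    (hf : Measurable f) {η : ℝ} (hη : 0 < η) (hη4 : η < 1 / 4)
    (hfp : ∀ i, Integrable (fun ω => |f (X i ω)| ^ (2 + η)) P) {C : ℝ} (hC0 : 0 ≤ C)
    (hC : ∀ (m k : ℕ) (hk : k + 1 + m + 1 = T) (ε : ℝ), 0 < ε →
      P {ω | |contValue π f m (k + 1) (past X (k + 1) (by omega) ω)
        - f (X ⟨k, by omega⟩ ω)| < ε} ≤ ENNReal.ofReal (C * ε))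
    (m k : ℕ) (hk : k + m + 1 = T) :
    ∫⁻ ω, ∫⁻ z, ENNReal.ofReal (|z.1| ^ (2 + gain T η k))
        ∂muse π f (museParam T η hη) m k (past X k (by omega) ω) ∂P < ⊤ ∧
      ∀ᵐ h ∂P.map (past X k (by omega)),
        ∫ z, z.1 ∂muse π f (museParam T η hη) m k h = contValue π f m k h := by
  have hfm : ∀ (i : Fin T) {k : ℕ}, k < T →
      ∫⁻ ω, ENNReal.ofReal (|f (X i ω)| ^ (2 + gain T η k)) ∂P < ⊤ := fun i k hkT => by
    have h1 := integrable_abs_rpow_of_le (q := 2 + gain T η k)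
      (by linarith [gain_pos (T := T) hη k]) (by linarith [gain_le hη hkT])
      (hf.comp (hX i)).aestronglyMeasurable (hfp i)
    have h2 := h1.2
    rwa [hasFiniteIntegral_iff_ofReal (ae_of_all _ fun z => by positivity)] at h2
  -- Moments and mean must go together: the moment step needs the mean of the recursive calls to be
  -- the value of continuing, for which the small-ball hypothesis is stated, and the mean step needs
  -- the integrability supplied by the moments.
  induction m generalizing k with
  | zero =>
    constructor
    · have hkT : k < T := by omega
      simp only [lintegral_muse_zero π hf (museParam T η hη) k _
        (F := fun z => ENNReal.ofReal (|z.1| ^ (2 + gain T η k))) (by fun_prop)]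
      have h1 := lintegral_past_succ hX hπ k hkT
        (H := fun h => ENNReal.ofReal (|f (h (Fin.last k))| ^ (2 + gain T η k))) (by fun_prop)
      simp only [extend_last] at h1
      rw [← h1]
      exact hfm ⟨k, hkT⟩ hkT
    · refine ae_of_all _ fun h => ?_
      rw [muse, Kernel.map_apply _ (by fun_prop), integral_map (by fun_prop)
        measurable_fst.aestronglyMeasurable, contValue]
  | succ m ih =>
    have hkT : k < T := by omega
    obtain ⟨ih1, ih2⟩ := ih (k + 1) (by omega)
    have hd := gain_pos (T := T) hη (k + 1)
    have hd4 : gain T η (k + 1) < 1 / 4 := (gain_le hη (by omega)).trans_lt hη4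
    have hmom := lintegral_muse_succ_rpow_lt_top hX hπ hf (museParam T η hη) m k hkT hd hd4
      (museParam_coe hη k) ih1 (hfm ⟨k, hkT⟩ (by omega))
      (ae_of_ae_map (measurable_past hX _ _).aemeasurable ih2) hC0 (hC m k (by omega))
    rw [← gain_succ] at hmom
    refine ⟨hmom, ?_⟩
    filter_upwards [ae_integrable_muse_rpow hX hkT.le hmom,
      ae_past_succ hX hπ k hkT (ae_integrable_muse_rpow hX hkT ih1),
      ae_past_succ hX hπ k hkT ih2] with h h1 h2 h3
    have := isMarkovKernel_muse π hf (museParam T η hη) (m + 1) k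
    refine integral_fst_muse_succ π hf _ m k (museParam_ne_zero hη hη4 (by omega))
      (museParam_ne_one hη k) (p := 2 + gain T η (k + 1)) (by linarith) (by linarith)
      (integrable_of_abs_rpow measurable_fst (by linarith [gain_pos (T := T) hη k]) h1) ?_
    filter_upwards [h2, h3] with x hx2 hx3 using ⟨hx2, hx3⟩

end Recursion

/-! ### The cost -/

lemma three_add_arithCost_le (n : ℕ) : 3 + arithCost n ≤ 11 * 2 ^ n := by
  cases n with
  | zero => simp [arithCost]
  | succ n =>
    have := Nat.lt_two_pow_self (n := n)
    simp only [arithCost, pow_succ]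
    omega

/-- The bound is uniform in the history. A call at level n makes 2^n recursive calls and does at
most 11 · 2^n further work, so the bound is multiplied by at most E 2^N after adding 11. That mean
is a geometric series with ratio 2^(1-ρ), convergent as the rate ρ exceeds 1. -/
theorem exists_cost_le (π : (k : ℕ) → Kernel (Fin k → 𝒳) 𝒳) [∀ k, IsMarkovKernel (π k)]
    {f : 𝒳 → ℝ} (hf : Measurable f) {T : ℕ} {η : ℝ} (hη : 0 < η) (hη4 : η < 1 / 4) (m k : ℕ)
    (hk : k + m + 1 = T) :
    ∃ c : ENNReal, c < ⊤ ∧ ∀ h, ∫⁻ z, (z.2 : ENNReal) ∂muse π f (museParam T η hη) m k h ≤ c := by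
  induction m generalizing k with
  | zero =>
    refine ⟨2, by norm_num, fun h => ?_⟩
    rw [lintegral_muse_zero π hf _ _ _ (by fun_prop)]
    simp
  | succ m ih =>
    obtain ⟨c, hc, hcm⟩ := ih (k + 1) (by omega)
    have := fun h => (isMarkovKernel_muse π hf (museParam T η hη) m (k + 1)).isProbabilityMeasure h
    have hkT : k + 1 < T := by omega
    have hrate := one_lt_rateOf_gain hη hη4 hkT
    set r := museParam T η hη (k + 1) with hr
    set ρ := rateOf (gain T η (k + 1)) with hρ
    have hrc : (r : ℝ) = 1 - 2 ^ (-ρ) := museParam_coe hη k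
    have hr0 : 0 ≤ (r : ℝ) := r.2.1
    have hθ : (2 : ℝ) ^ (1 - ρ) < 1 :=
      Real.rpow_lt_one_of_one_lt_of_neg one_lt_two (by linarith)
    have hsum : Summable fun n : ℕ => (r : ℝ) * ((2 : ℝ) ^ (1 - ρ)) ^ n :=
      (summable_geometric_of_lt_one (by positivity) hθ).mul_left _
    refine ⟨(∑' n : ℕ, ENNReal.ofReal ((r : ℝ) * ((2 : ℝ) ^ (1 - ρ)) ^ n)) * (c + 11),
      ENNReal.mul_lt_top hsum.tsum_ofReal_lt_top (by finiteness), fun h => ?_⟩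
    rw [lintegral_muse_succ π hf _ m k (museParam_ne_zero hη hη4 hkT) h (by fun_prop), ← hr]
    have hbd : ∀ x, ∑' n, ENNReal.ofReal (geoPMF r n) *
        ∫⁻ y : Fin (2 ^ n) → ℝ × ℕ, ((combine r n (f x) y).2 : ENNReal)
          ∂Measure.pi (fun _ => muse π f (museParam T η hη) m (k + 1) (extend (h, x))) ≤
        (∑' n : ℕ, ENNReal.ofReal ((r : ℝ) * ((2 : ℝ) ^ (1 - ρ)) ^ n)) * (c + 11) := by
      intro x
      rw [← ENNReal.tsum_mul_right]
      refine ENNReal.tsum_le_tsum fun n => ?_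
      have h1 : ∫⁻ y : Fin (2 ^ n) → ℝ × ℕ, ((combine r n (f x) y).2 : ENNReal)
          ∂Measure.pi (fun _ => muse π f (museParam T η hη) m (k + 1) (extend (h, x))) ≤
          2 ^ n * (c + 11) := by
        have h2 : ∀ y : Fin (2 ^ n) → ℝ × ℕ, ((combine r n (f x) y).2 : ENNReal) ≤
            (∑ i, ((y i).2 : ENNReal)) + 2 ^ n * 11 := fun y => by
          have h3 : (combine r n (f x) y).2 ≤ (∑ i, (y i).2) + 2 ^ n * 11 := by
            have := three_add_arithCost_le n
            simp only [combine]; omega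
          exact_mod_cast h3
        refine (lintegral_mono h2).trans ?_
        rw [lintegral_add_right _ measurable_const, lintegral_finsetSum _ (by fun_prop),
          lintegral_const, measure_univ, mul_one, mul_add]
        refine add_le_add ((Finset.sum_le_sum (g := fun _ => c) fun i _ => ?_).trans
          (le_of_eq ?_)) le_rfl
        · rw [(measurePreserving_eval (fun _ : Fin (2 ^ n) =>
            muse π f (museParam T η hη) m (k + 1) (extend (h, x))) i).lintegral_comp
            (f := fun z => (z.2 : ENNReal)) (by fun_prop)]
          exact hcm _
        · simp
      refine (mul_le_mul_right h1 _).trans (le_of_eq ?_)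
      rw [← mul_assoc]
      congr 1
      have e1 : (2 : ENNReal) ^ n = ENNReal.ofReal (2 ^ n) := by
        rw [ENNReal.ofReal_pow two_pos.le]; simp
      have e2 : geoPMF r n = r * ((2 : ℝ) ^ (-ρ)) ^ n := by
        rw [geoPMF, show 1 - (r : ℝ) = 2 ^ (-ρ) by linarith]
      rw [e1, e2, ← ENNReal.ofReal_mul (by positivity), mul_assoc, ← mul_pow]
      congr 3
      rw [sub_eq_neg_add, Real.rpow_add two_pos, Real.rpow_one]
    refine (lintegral_mono hbd).trans ?_
    rw [lintegral_const, measure_univ, mul_one]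

/-! ### Averages -/

section Average

variable {μ : Measure (ℝ × ℕ)} [IsProbabilityMeasure μ]

lemma measurable_average (n : ℕ) : Measurable fun y : Fin n → ℝ × ℕ =>
    (((∑ i, (y i).1) / n, (∑ i, (y i).2) + n) : ℝ × ℕ) := by fun_prop

instance isProbabilityMeasure_averageLaw (n : ℕ) : IsProbabilityMeasure (averageLaw μ n) :=
  Measure.isProbabilityMeasure_map (measurable_average n).aemeasurable

lemma lintegral_averageLaw_sq (h2 : MemLp (fun z : ℝ × ℕ => z.1) 2 μ) {n : ℕ} (hn : n ≠ 0) :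
    ∫⁻ z, ENNReal.ofReal ((z.1 - ∫ w, w.1 ∂μ) ^ 2) ∂averageLaw μ n =
      ENNReal.ofReal (variance (fun z : ℝ × ℕ => z.1) μ / n) := by
  set U := ∫ w, w.1 ∂μ with hU
  set ν : Measure (Fin n → ℝ × ℕ) := Measure.pi fun _ => μ with hν
  set S : (Fin n → ℝ × ℕ) → ℝ := ∑ i, fun y => (y i).1 with hS
  have hSy : ∀ y, S y = ∑ i, (y i).1 := fun y => by simp [hS]
  have hn' : (n : ℝ) ≠ 0 := Nat.cast_ne_zero.2 hn
  have hev : ∀ i, MemLp (fun y : Fin n → ℝ × ℕ => (y i).1) 2 ν := fun i =>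
    h2.comp_measurePreserving (measurePreserving_eval (fun _ => μ) i)
  have hS2 : MemLp S 2 ν := memLp_finsetSum' _ fun i _ => hev i
  have hvar : variance S ν = n * variance (fun z : ℝ × ℕ => z.1) μ := by
    have := variance_sum_pi (μ := fun _ : Fin n => μ) (X := fun _ z => z.1) fun _ => h2
    rw [hS, this]; simp
  have hmean : ∫ y, S y ∂ν = n * U := by
    simp only [hSy]
    rw [integral_finsetSum _ fun i _ => (hev i).integrable (by norm_num)]
    have : ∀ i : Fin n, ∫ y : Fin n → ℝ × ℕ, (y i).1 ∂ν = U := fun i => by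
      rw [hU, ← (measurePreserving_eval (fun _ : Fin n => μ) i).map_eq,
        integral_map (measurable_pi_apply i).aemeasurable measurable_fst.aestronglyMeasurable]
    simp [this]
  rw [variance_eq_integral hS2.aemeasurable, hmean] at hvar
  have e : ∀ y, ((∑ i, (y i).1) / n - U) ^ 2 = (S y - n * U) ^ 2 / (n : ℝ) ^ 2 := fun y => by
    rw [hSy]; field_simp
  rw [averageLaw, lintegral_map (by fun_prop) (measurable_average n)]
  simp only [e]
  have hi : Integrable (fun y => (S y - n * U) ^ 2 / (n : ℝ) ^ 2) ν :=
    (hS2.sub (memLp_const _)).integrable_sq.div_const _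
  rw [← ofReal_integral_eq_lintegral_ofReal hi (ae_of_all _ fun y => by positivity),
    integral_div, hvar]
  congr 1
  field_simp

lemma lintegral_averageLaw_cost (n : ℕ) :
    ∫⁻ z, (z.2 : ENNReal) ∂averageLaw μ n = n * (∫⁻ z, (z.2 : ENNReal) ∂μ + 1) := by
  rw [averageLaw, lintegral_map (by fun_prop) (measurable_average n)]
  push_cast
  rw [lintegral_add_right _ measurable_const, lintegral_finsetSum _ (by fun_prop), lintegral_const,
    measure_univ, mul_one]
  have : ∀ i : Fin n, ∫⁻ y : Fin n → ℝ × ℕ, ((y i).2 : ENNReal) ∂(Measure.pi fun _ => μ) =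
      ∫⁻ z, (z.2 : ENNReal) ∂μ := fun i =>
    (measurePreserving_eval (fun _ : Fin n => μ) i).lintegral_comp
      (f := fun z => (z.2 : ENNReal)) (by fun_prop)
  simp only [this, Finset.sum_const, Finset.card_univ, Fintype.card_fin, nsmul_eq_mul]
  ring

lemma sampleSize_pos (V ε : ℝ) : 0 < sampleSize V ε := lt_of_lt_of_le one_pos (le_max_left _ _)

lemma div_sampleSize_le (V : ℝ) {ε : ℝ} (hε : 0 < ε) : V / sampleSize V ε ≤ ε ^ 2 := by
  have h1 : V / ε ^ 2 ≤ sampleSize V ε :=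
    (Nat.le_ceil _).trans (Nat.cast_le.2 (le_max_right _ _))
  have h2 : (0 : ℝ) < sampleSize V ε := Nat.cast_pos.2 (sampleSize_pos V ε)
  rw [div_le_iff₀ (by positivity)] at h1
  rw [div_le_iff₀ h2]
  linarith

lemma sampleSize_le {V : ℝ} (hV : 0 ≤ V) {ε : ℝ} (hε : 0 < ε) :
    (sampleSize V ε : ℝ) ≤ (V + 1) * max 1 (1 / ε ^ 2) := by
  have h1 : (1 : ℝ) ≤ max 1 (1 / ε ^ 2) := le_max_left _ _
  have h2 : V / ε ^ 2 ≤ V * max 1 (1 / ε ^ 2) := by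
    rw [div_eq_mul_one_div]; exact mul_le_mul_of_nonneg_left (le_max_right _ _) hV
  rw [sampleSize, Nat.cast_max, Nat.cast_one]
  refine max_le ?_ ?_
  · nlinarith
  · have := (Nat.ceil_lt_add_one (by positivity : 0 ≤ V / ε ^ 2)).le
    linarith

end Average

end MUSE

/-! ### The main theorem -/

theorem corollary1
    {𝒳 : Type*} [NormedAddCommGroup 𝒳] [NormedSpace ℝ 𝒳] [CompleteSpace 𝒳]
    [SecondCountableTopology 𝒳] [MeasurableSpace 𝒳] [BorelSpace 𝒳]
    {Ω : Type*} [MeasurableSpace Ω] (P : Measure Ω) [IsProbabilityMeasure P]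
    (T : ℕ) (hT : 1 ≤ T)
    -- the process and its simulator
    (X : Fin T → Ω → 𝒳) (hX : ∀ i, StronglyMeasurable (X i))
    (π : (k : ℕ) → Kernel (Fin k → 𝒳) 𝒳) [∀ k, IsMarkovKernel (π k)]
    (hπ : MUSE.Simulates P X π)
    -- moments
    (δ : ℝ) (hδ : 0 < δ) (hmoment : ∀ i, Integrable (fun ω => ‖X i ω‖ ^ (2 + δ)) P)
    -- linear growth of the reward
    (f : 𝒳 → ℝ) (hf : Measurable f) (L : ℝ) (hL : ∀ x, |f x| ≤ L * (1 + ‖x‖))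
    -- regularity of the conditional utility
    (C : ℝ)
    (hC : ∀ (k : ℕ) (hk : k + 1 < T) (ε : ℝ), 0 < ε →
      P.real {ω | |MUSE.condUtility π f (T - (k + 1)) (k + 1) (MUSE.past X (k + 1) hk.le ω)
        - f (X ⟨k, by omega⟩ ω)| < ε} ≤ C * ε) :
    ∀ (η : ℝ) (hη : 0 < η), η ≤ δ → η < 1 / 4 →
      let μ : Measure (ℝ × ℕ) := MUSE.museLaw π f (MUSE.museParam T η hη) T
      let n : ℝ → ℕ := fun ε => MUSE.sampleSize (variance (fun z : ℝ × ℕ => z.1) μ) ε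
      let ν : ℝ → Measure (ℝ × ℕ) := fun ε => MUSE.averageLaw μ (n ε)
      IsProbabilityMeasure μ ∧ MemLp (fun z : ℝ × ℕ => z.1) 2 μ ∧
      ∃ K : ℝ, ∀ ε : ℝ, 0 < ε →
        IsProbabilityMeasure (ν ε) ∧
        ∫⁻ z, ENNReal.ofReal ((z.1 - MUSE.stoppingValue P X hX f) ^ 2) ∂(ν ε)
          ≤ ENNReal.ofReal (ε ^ 2) ∧
        ∫⁻ z, (z.2 : ENNReal) ∂(ν ε) ≤ ENNReal.ofReal (K * max 1 (1 / ε ^ 2)) := by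
  intro η hη hηδ hη4 μ n ν
  obtain ⟨m, rfl⟩ : ∃ m, T = m + 1 := ⟨T - 1, by omega⟩
  have hXm : ∀ i, Measurable (X i) := fun i => (hX i).measurable
  have hL0 : 0 ≤ L := by
    have := (abs_nonneg _).trans (hL 0); simpa using this
  have hfp : ∀ i, Integrable (fun ω => |f (X i ω)| ^ (2 + η)) P := by
    intro i
    have hY : Measurable fun ω => f (X i ω) := hf.comp (hXm i)
    refine MUSE.integrable_abs_rpow_of_le (p := 2 + δ) (by linarith) (by linarith)
      hY.aestronglyMeasurable ?_
    have hb : Integrable (fun ω => (2 * L) ^ (2 + δ) * (1 + ‖X i ω‖ ^ (2 + δ))) P :=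
      ((integrable_const 1).add (hmoment i)).const_mul _
    refine hb.mono' (Measurable.aestronglyMeasurable (by fun_prop)) (ae_of_all _ fun ω => ?_)
    rw [Real.norm_of_nonneg (by positivity)]
    have h0 := norm_nonneg (X i ω)
    have h1 : |f (X i ω)| ≤ 2 * L * max 1 ‖X i ω‖ := by
      refine (hL _).trans ?_
      nlinarith [le_max_left 1 ‖X i ω‖, le_max_right 1 ‖X i ω‖]
    have h2 : max 1 ‖X i ω‖ ^ (2 + δ) ≤ 1 + ‖X i ω‖ ^ (2 + δ) := by
      rcases max_choice 1 ‖X i ω‖ with e | e <;> rw [e]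
      · rw [Real.one_rpow]; have : 0 ≤ ‖X i ω‖ ^ (2 + δ) := by positivity
        linarith
      · linarith
    calc |f (X i ω)| ^ (2 + δ) ≤ (2 * L * max 1 ‖X i ω‖) ^ (2 + δ) :=
          Real.rpow_le_rpow (abs_nonneg _) h1 (by linarith)
      _ = (2 * L) ^ (2 + δ) * max 1 ‖X i ω‖ ^ (2 + δ) :=
          Real.mul_rpow (by positivity) (by positivity)
      _ ≤ _ := by gcongr
  have hfi : ∀ i, Integrable (fun ω => f (X i ω)) P := fun i =>
    MUSE.integrable_of_abs_rpow (p := 2 + η) (hf.comp (hXm i)) (by linarith) (hfp i)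
  -- The two descriptions of the value of continuing agree at histories with finite `absRewards`,
  -- hence almost surely. The constant becomes `max C 0` because for T = 1 the hypothesis is vacuous
  -- and C may be negative.
  have hC' : ∀ (m' k : ℕ) (hk : k + 1 + m' + 1 = m + 1) (ε : ℝ), 0 < ε →
      P {ω | |MUSE.contValue π f m' (k + 1) (MUSE.past X (k + 1) (by omega) ω)
        - f (X ⟨k, by omega⟩ ω)| < ε} ≤ ENNReal.ofReal (max C 0 * ε) := by
    intro m' k hk ε hε
    have h1 := hC k (by omega) ε hε
    have e : m + 1 - (k + 1) = m' + 1 := by omega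
    rw [e] at h1
    have hae := ae_of_ae_map (MUSE.measurable_past hXm (k + 1) (by omega)).aemeasurable
      (MUSE.ae_absRewards_past_ne_top hXm hπ hf hfi (m' + 1) (k + 1) (by omega))
    have h2 : P {ω | |MUSE.contValue π f m' (k + 1) (MUSE.past X (k + 1) (by omega) ω)
        - f (X ⟨k, by omega⟩ ω)| < ε} =
        P {ω | |MUSE.condUtility π f (m' + 1) (k + 1) (MUSE.past X (k + 1) (by omega) ω)
        - f (X ⟨k, by omega⟩ ω)| < ε} := by
      refine measure_congr ?_
      filter_upwards [hae] with ω hω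
      rw [eq_iff_iff]
      change |MUSE.contValue π f m' (k + 1) (MUSE.past X (k + 1) (by omega) ω)
        - f (X ⟨k, by omega⟩ ω)| < ε ↔ |MUSE.condUtility π f (m' + 1) (k + 1)
          (MUSE.past X (k + 1) (by omega) ω) - f (X ⟨k, by omega⟩ ω)| < ε
      rw [MUSE.condUtility_eq_contValue π hf m' (k + 1) _ hω]
    rw [h2, ← ENNReal.ofReal_toReal (measure_ne_top P _)]
    refine ENNReal.ofReal_le_ofReal (h1.trans ?_)
    gcongr
    exact le_max_left _ _
  obtain ⟨hmom, hmean⟩ := MUSE.muse_moment_and_mean hXm hπ hf hη hη4 hfp (le_max_right C 0) hC'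
    m 0 (by omega)
  have hpast : ∀ ω, MUSE.past X 0 (Nat.zero_le _) ω = Fin.elim0 := fun ω => Subsingleton.elim _ _
  have hμ : IsProbabilityMeasure μ :=
    (MUSE.isMarkovKernel_muse π hf (MUSE.museParam (m + 1) η hη) m 0).isProbabilityMeasure _
  have hmeanμ : ∫ z, z.1 ∂μ = MUSE.stoppingValue P X hX f := by
    rw [MUSE.stoppingValue_eq_contValue hX hπ hf hfi]
    -- There is only one empty history, so the almost sure statement about it, read at a single ω,
    -- is the statement at `Fin.elim0`.
    obtain ⟨ω, hω⟩ := (ae_of_ae_map (MUSE.measurable_past hXm 0 (by omega)).aemeasurable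
      hmean).exists
    rw [hpast] at hω
    exact hω
  have hmem : MemLp (fun z : ℝ × ℕ => z.1) 2 μ := by
    simp only [hpast, lintegral_const, measure_univ, mul_one] at hmom
    have h1 := MUSE.integrable_abs_rpow_of_le (q := 2) (by norm_num)
      (by linarith [MUSE.gain_pos (T := m + 1) hη 0]) measurable_fst.aestronglyMeasurable
      (MUSE.integrable_abs_rpow_of_lintegral (κ := μ) measurable_fst hmom)
    rw [memLp_two_iff_integrable_sq measurable_fst.aestronglyMeasurable]
    refine h1.congr (ae_of_all _ fun z => ?_)
    change |z.1| ^ (2 : ℝ) = z.1 ^ 2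
    rw [← sq_abs]; norm_cast
  obtain ⟨c, hc, hcost⟩ := MUSE.exists_cost_le π hf hη hη4 m 0 (T := m + 1) (by omega)
  have hcostμ : ∫⁻ z, (z.2 : ENNReal) ∂μ ≤ c := hcost _
  -- At most (Var + 1) max(1, 1/ε²) runs are averaged, each costing at most c in the mean plus one
  -- operation of the averaging.
  refine ⟨hμ, hmem, (variance (fun z : ℝ × ℕ => z.1) μ + 1) * (c.toReal + 1), fun ε hε =>
    ⟨MUSE.isProbabilityMeasure_averageLaw _, ?_, ?_⟩⟩
  · rw [← hmeanμ, MUSE.lintegral_averageLaw_sq hmem (MUSE.sampleSize_pos _ _).ne']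
    exact ENNReal.ofReal_le_ofReal (MUSE.div_sampleSize_le _ hε)
  · rw [MUSE.lintegral_averageLaw_cost]
    have h1 := MUSE.sampleSize_le (variance_nonneg (fun z : ℝ × ℕ => z.1) μ) hε
    have e : c + 1 = ENNReal.ofReal (c.toReal + 1) := by
      rw [ENNReal.ofReal_add ENNReal.toReal_nonneg zero_le_one, ENNReal.ofReal_toReal hc.ne,
        ENNReal.ofReal_one]
    calc _ ≤ (n ε : ENNReal) * (c + 1) := by gcongr
      _ = ENNReal.ofReal (n ε * (c.toReal + 1)) := by
        rw [e, ENNReal.ofReal_mul (Nat.cast_nonneg _), ENNReal.ofReal_natCast]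
      _ ≤ _ := by
        refine ENNReal.ofReal_le_ofReal ?_
        have h3 := mul_le_mul_of_nonneg_right h1 (by positivity : 0 ≤ c.toReal + 1)
        calc _ ≤ _ := h3
          _ = _ := by ring

end
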